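/- Let $(X_i,Y_i)_{i\ge 1}$ be i.i.d. copies of $(X,Y)$, where $X\in\mathbb R^f$ is a feature vector and $Y=(Y^{(1)},\dots,Y^{(c)})\in\{0,1\}^c$ is a class identification vector. Of the first $n$ observations all $X_i$ are known, but $Y_i$ is known only for $i\le r=r_n\le n$; assume $r_n/n\to\gamma>0$ as $n\to\infty$. Fix a class $j$ and suppose that $P(Y^{(j)}=1\mid X)=g(X,\theta_j)$ almost surely, where $g:\mathbb R^f\times\mathbb R^k\to\mathbb R$ is measurable and $\theta_j$ is an interior point of a compact set $\Theta\subset\mathbb R^k$. Write $g'$ and $g''$ for the gradient and the Hessian of $g$ in its second argument and $w(t,\theta)=1/\{g(t,\theta)[1-g(t,\theta)]\}$. Assume the following regularity conditions. 1. For almost every $t$ under the law of $X$ and all $\theta\in\Theta$: $0<g(t,\theta)<1$, and $g(t,\cdot)$ is twice continuously differentiable in a neighbourhood of $\theta$. 2. There is $H$ with $E|H(X)|<\infty$ such that, for almost every $t$ under the law of $X$ and all $\theta\in\Theta$, $(w(t,\theta)\|g'(t,\theta)\|)^2\le H(t)$ and $w(t,\theta)\|g''(t,\theta)\|\le H(t)$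 (the latter with the operator norm). 3. $\theta_j$ is the only $\theta\in\Theta$ with $E[w(X,\theta)\{Y^{(j)}-g(X,\theta)\}g'(X,\theta)]=0$. 4. The matrix $A_j=E[w(X,\theta_j)g'(X,\theta_j)g'(X,\theta_j)^T]$ is invertible. Let $\hat\theta_j=\hat\theta_{j,n}$ be random vectors which, with probability tending to $1$, lie in $\Theta$ and solve the weighted least squares estimating equation $$0=\sum_{i=1}^{r} w(X_i,\hat\theta_j)\{Y_i^{(j)}-g(X_i,\hat\theta_j)\}\,g'(X_i,\hat\theta_j).$$ Let $W\subset\mathbb R^f$ be a Borel set with $P(X\in W)>0$, let $I_W$ be its indicator function, and let $q_{j,W}=P(Y^{(j)}=1\mid X\in W)$. Consider the estimator based on labeled and unlabeled data and the ordinary estimator based only on the labeled $Y$ values, $$\hat q_{j,W}=\frac{\sum_{i=1}^n g(X_i,\hat\theta_j)I_W(X_i)}{\sum_{i=1}^n I_W(X_i)},\qquad \bar Y^{(j,W)}=\frac{\frac1r\sum_{i=1}^r I_W(X_i)Y_i^{(j)}}{\frac1n\sum_{i=1}^n I_W(X_i)}.$$ Say that an estimator $T_n$ of $q$ has asymptotic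 variance $v\ge 0$ if $\sqrt n\,(T_n-q)$ converges in distribution to $N(0,v)$ (the point mass at $0$ if $v=0$). Then, as estimators of $q_{j,W}$, both $\hat q_{j,W}$ and $\bar Y^{(j,W)}$ have an asymptotic variance, and that of $\hat q_{j,W}$ is less than or equal to that of $\bar Y^{(j,W)}$. If moreover $\gamma<1$ and the random variable $I_W(X)g(X,\theta_j)$ is not almost surely constant, then the inequality is strict. -/

import Mathlib

open MeasureTheory ProbabilityTheory Filter Topology

noncomputable section

namespace SubclassEstimation

/-- Feature vectors: `ℝ^f`. -/
abbrev Feature (f : ℕ) := EuclideanSpace ℝ (Fin f)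

/-- Parameter vectors: `ℝ^k`. -/
abbrev Param (k : ℕ) := EuclideanSpace ℝ (Fin k)

variable {f k : ℕ} {Ω : Type*}

/-- `w(t, θ) = 1 / (g(t, θ) (1 - g(t, θ)))`, the reciprocal of the conditional variance of a
`0`-`1` variable with success probability `g(t, θ)`. -/
def weight (g : Feature f → Param k → ℝ) (t : Feature f) (θ : Param k) : ℝ :=
  1 / (g t θ * (1 - g t θ))

/-- `g'(t, θ)`, the vector of partial derivatives of `g` in its second argument. -/
def grad (g : Feature f → Param k → ℝ) (t : Feature f) (θ : Param k) : Param k :=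
  gradient (g t) θ

/-- `g''(t, θ)`, the Hessian of `g` in its second argument, as a linear operator. -/
def hess (g : Feature f → Param k → ℝ) (t : Feature f) (θ : Param k) :
    Param k →L[ℝ] Param k :=
  fderiv ℝ (grad g t) θ

/-- The contribution `w(t, θ) (y - g(t, θ)) g'(t, θ)` of an observation with feature vector `t`
and class indicator `y` to the weighted least squares estimating equation. -/
def score (g : Feature f → Param k → ℝ) (t : Feature f) (y : ℝ) (θ : Param k) : Param k :=
  (weight g t θ * (y - g t θ)) • grad g t θ

/-- The matrix `E[w(X, θ) g'(X, θ) g'(X, θ)ᵀ]`. -/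
def infoMatrix [MeasurableSpace Ω] (P : Measure Ω) (X : Ω → Feature f)
    (g : Feature f → Param k → ℝ) (θ : Param k) : Matrix (Fin k) (Fin k) ℝ :=
  Matrix.of fun a b => ∫ ω, weight g (X ω) θ * grad g (X ω) θ a * grad g (X ω) θ b ∂P

/-- `I_W`, the indicator function of `W`. -/
def ind (W : Set (Feature f)) (t : Feature f) : ℝ := W.indicator (fun _ => (1 : ℝ)) t

/-- The subclass probability `q_{j,W} = P(Y^{(j)} = 1 | X ∈ W)`. -/
def subclassProb {c : ℕ} [MeasurableSpace Ω] (P : Measure Ω) (X : Ω → Feature f)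
    (Y : Ω → Fin c → ℝ) (j : Fin c) (W : Set (Feature f)) : ℝ :=
  (P[|{ω | X ω ∈ W}]).real {ω | Y ω j = 1}

/-- The value `θ` solves the weighted least squares estimating equation built from the first `r`
(labeled) observations of the `j`-th class indicator, at the sample point `ω`. -/
def IsRoot {c : ℕ} (X : ℕ → Ω → Feature f) (Y : ℕ → Ω → Fin c → ℝ) (j : Fin c)
    (g : Feature f → Param k → ℝ) (r : ℕ) (ω : Ω) (θ : Param k) : Prop :=
  ∑ i ∈ Finset.range r, score g (X i ω) (Y i ω j) θ = 0

/-- The estimator that uses labeled and unlabeled data,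
`q̂_{j,W} = (∑_{i ≤ n} g(X_i, θ̂) I_W(X_i)) / (∑_{i ≤ n} I_W(X_i))`. -/
def qHat (X : ℕ → Ω → Feature f) (g : Feature f → Param k → ℝ) (W : Set (Feature f))
    (θhat : Ω → Param k) (n : ℕ) (ω : Ω) : ℝ :=
  (∑ i ∈ Finset.range n, g (X i ω) (θhat ω) * ind W (X i ω)) /
    ∑ i ∈ Finset.range n, ind W (X i ω)

/-- The ordinary estimator, which uses only the labeled `Y` values,
`Ȳ^{(j,W)} = ((1/r) ∑_{i ≤ r} I_W(X_i) Y_i^{(j)}) / ((1/n) ∑_{i ≤ n} I_W(X_i))`. -/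
def yBar {c : ℕ} (X : ℕ → Ω → Feature f) (Y : ℕ → Ω → Fin c → ℝ) (j : Fin c)
    (W : Set (Feature f)) (r n : ℕ) (ω : Ω) : ℝ :=
  ((1 / (r : ℝ)) * ∑ i ∈ Finset.range r, ind W (X i ω) * Y i ω j) /
    ((1 / (n : ℝ)) * ∑ i ∈ Finset.range n, ind W (X i ω))

/-- `T n` is an asymptotically normal estimator of `q` with asymptotic variance `v` (on the
`√n` scale): `√n (T n - q)` converges in distribution to `N(0, v)`. The variance `v = 0` is
allowed and means convergence to the constant `0`. -/
def HasAsymptoticVariance [MeasurableSpace Ω] (P : Measure Ω) [IsProbabilityMeasure P]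
    (T : ℕ → Ω → ℝ) (q : ℝ) (v : NNReal) : Prop :=
  TendstoInDistribution (fun (n : ℕ) ω => √(n : ℝ) * (T n ω - q)) atTop (id : ℝ → ℝ)
    (fun _ => P) (gaussianReal 0 v)

/-- Regularity of the parametric family `g` on the parameter set `Θ` for the feature law `μ`:
values strictly between `0` and `1` (so that the weights make sense), twice continuous
differentiability in the parameter, and domination of the (squared) weighted gradient and of the
weighted Hessian, uniformly over `Θ`, by a `μ`-integrable function. -/
structure RegularFamily (μ : Measure (Feature f)) (g : Feature f → Param k → ℝ)
    (Θ : Set (Param k)) : Prop where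
  measurable : Measurable fun p : Feature f × Param k => g p.1 p.2
  mem_Ioo : ∀ᵐ t ∂μ, ∀ θ ∈ Θ, g t θ ∈ Set.Ioo (0 : ℝ) 1
  contDiffAt : ∀ᵐ t ∂μ, ∀ θ ∈ Θ, ContDiffAt ℝ 2 (g t) θ
  dominated : ∃ H : Feature f → ℝ, Integrable H μ ∧
    ∀ᵐ t ∂μ, ∀ θ ∈ Θ, (weight g t θ * ‖grad g t θ‖) ^ 2 ≤ H t ∧ weight g t θ * ‖hess g t θ‖ ≤ H t

end SubclassEstimation

end

/-! Write `p = P(X ∈ W)`, `m = E[I_W g]` and `q = m / p`, with `g` taken at the true parameter. Both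
estimators have the denominator `D_n`, the mean of `I_W` over all `n` features, which tends to `p`.
So it suffices to compare the numerators minus `q D_n`; Slutsky contributes the same factor `p⁻²` to
both variances.

Put `A = I_W g - m`, `Q = q I_W - m`, `R = I_W (Y - g)` and `S = ⟪score, c⟫`, where `c` solves `E[w
g' g'ᵀ] c = E[I_W g']`. All four are centred. The ordinary estimator has centred numerator (mean of
`A + R` over the `r` labeled observations) + (mean of `-Q` over all `n`). A root of the estimating
equation is consistent, and linearizing the equation and the numerator around the true parameter
turns the other centred numerator into (mean of `S` over the labeled ones) + (mean of `A - Q` over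
all), up to `o_P(n^{-1/2})`.

A central limit theorem for such sums of two means, of `U` and of `V`, gives the variance `γ⁻¹ E U²
+ 2 E UV + E V²` (`meanSumVar`). `R` and `S` are residuals times functions of `X`, hence orthogonal
to `A` and `Q`. As the conditional variance of the residual is `1 / w`, also `E RS = E S²`: `S` is
the projection of `R` onto the span of the score components. The difference of the variances is
then, by `meanSumVar_sub_meanSumVar`, `(γ⁻¹ - 1) E A² + γ⁻¹ E (R - S)²`. It is nonnegative since `γ
≤ 1`, and positive if `γ < 1` and `I_W g` is not almost surely constant.

The analysis rests on `exists_integrable_bound_near`, which controls dominated families uniformly in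
the parameter; `IsIIDSample.tendsto_root` (consistency) and
`IsIIDSample.eventually_norm_sampleMean_sub_le` (expansion) follow from it. The limit laws come from
`IsIIDSample.tendstoInDistribution_two_means`. -/

noncomputable section

open scoped ENNReal RealInnerProductSpace

/-! ### Calculus of `o_P` and `O_P` through a filter on `ℕ × Ω`. -/

section InProbability

variable {Ω E : Type*} [MeasurableSpace Ω] {P : Measure Ω}

/-- The filter on `ℕ × Ω` of the events that hold with probability tending to one. -/
def inProb (P : Measure Ω) : Filter (ℕ × Ω) where
  -- Requiring the outer measure of the complement to vanish in the limit, instead of `P S → 1`,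
  -- makes sense for nonmeasurable events as well: monotonicity and subadditivity are enough for a
  -- filter.
  sets := {S | Tendsto (fun n => P {ω | (n, ω) ∉ S}) atTop (𝓝 0)}
  univ_sets := by simp
  sets_of_superset {S U} hS hSU :=
    tendsto_of_tendsto_of_tendsto_of_le_of_le tendsto_const_nhds hS (fun _ => zero_le)
      fun _ => measure_mono fun _ hω h => hω (hSU h)
  inter_sets {S U} hS hU := by
    refine tendsto_of_tendsto_of_tendsto_of_le_of_le tendsto_const_nhds
      (by simpa using hS.add hU) (fun _ => zero_le) fun n => ?_
    refine (measure_mono fun ω hω => ?_).trans (measure_union_le _ _)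
    by_contra h
    simp only [Set.mem_union, Set.mem_ofPred_eq, not_or, not_not] at h
    exact hω h

lemma eventually_inProb {p : ℕ → Ω → Prop} :
    (∀ᶠ x in inProb P, p x.1 x.2) ↔ Tendsto (fun n => P {ω | ¬ p n ω}) atTop (𝓝 0) :=
  Iff.rfl

lemma eventually_inProb_of_ae {p : ℕ → Ω → Prop} (h : ∀ᶠ n in atTop, ∀ᵐ ω ∂P, p n ω) :
    ∀ᶠ x in inProb P, p x.1 x.2 := by
  rw [eventually_inProb]
  refine tendsto_const_nhds.congr' ?_
  filter_upwards [h] with n hn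
  exact (ae_iff.1 hn).symm

lemma eventually_inProb_of_eventually {p : ℕ → Prop} (h : ∀ᶠ n in atTop, p n) :
    ∀ᶠ x in inProb P, p x.1 :=
  eventually_inProb_of_ae (p := fun n _ => p n) (h.mono fun _ hn => .of_forall fun _ => hn)

lemma tendsto_fst_inProb : Tendsto Prod.fst (inProb P) atTop :=
  fun _ hs => eventually_inProb_of_eventually hs

/-- Lets limits in probability be read along the number `r n` of labeled observations instead of
`n`. -/
lemma tendsto_prodMap_inProb {m : ℕ → ℕ} (hm : Tendsto m atTop atTop) :
    Tendsto (fun x : ℕ × Ω => (m x.1, x.2)) (inProb P) (inProb P) :=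
  fun S hS => (eventually_inProb (p := fun n ω => (m n, ω) ∈ S)).2
    (((eventually_inProb (p := fun n ω => (n, ω) ∈ S)).1 hS).comp hm)

lemma tendsto_inProb_iff_tendstoInMeasure [PseudoEMetricSpace E] {F : ℕ → Ω → E} {c : E} :
    Tendsto (fun x => F x.1 x.2) (inProb P) (𝓝 c) ↔
      TendstoInMeasure P F atTop fun _ => c := by
  rw [EMetric.tendsto_nhds]
  refine forall₂_congr fun ε _ => ?_
  rw [eventually_inProb (p := fun n ω => edist (F n ω) c < ε)]
  simp only [not_lt]

/-- Boundedness in probability of a sequence of random elements. -/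
def BoundedInProb [Norm E] (P : Measure Ω) (F : ℕ → Ω → E) : Prop :=
  ∀ ε : ℝ≥0∞, 0 < ε → ∃ C : ℝ, ∀ᶠ n in atTop, P {ω | C < ‖F n ω‖} ≤ ε

/-- The exceptional set of the comparison has vanishing probability, so half of `ε` pays for it and
the other half for the tail of `G`. -/
lemma BoundedInProb.mono {E' : Type*} [Norm E] [Norm E'] {F : ℕ → Ω → E} {G : ℕ → Ω → E'}
    (hG : BoundedInProb P G) {K : ℝ} (hK : 0 ≤ K)
    (h : ∀ᶠ x in inProb P, ‖F x.1 x.2‖ ≤ K * ‖G x.1 x.2‖) : BoundedInProb P F := by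
  intro ε hε
  obtain ⟨C, hC⟩ := hG (ε / 2) (ENNReal.half_pos hε.ne')
  refine ⟨K * C, ?_⟩
  have h' := ENNReal.tendsto_nhds_zero.1
    ((eventually_inProb (p := fun n ω => ‖F n ω‖ ≤ K * ‖G n ω‖)).1 h) _ (ENNReal.half_pos hε.ne')
  filter_upwards [hC, h'] with n h1 h2
  calc P {ω | K * C < ‖F n ω‖}
      ≤ P ({ω | C < ‖G n ω‖} ∪ {ω | ¬ ‖F n ω‖ ≤ K * ‖G n ω‖}) := by
        refine measure_mono fun ω hω => ?_
        by_contra hcon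
        simp only [Set.mem_union, Set.mem_ofPred_eq, not_or, not_not, not_lt] at hcon hω
        exact absurd (hω.trans_le hcon.2) (not_lt.2 (mul_le_mul_of_nonneg_left hcon.1 hK))
    _ ≤ ε / 2 + ε / 2 := (measure_union_le _ _).trans (add_le_add h1 h2)
    _ = ε := ENNReal.add_halves ε

lemma BoundedInProb.add [SeminormedAddCommGroup E] {F G : ℕ → Ω → E}
    (hF : BoundedInProb P F) (hG : BoundedInProb P G) :
    BoundedInProb P fun n ω => F n ω + G n ω := by
  intro ε hε
  obtain ⟨C, hC⟩ := hF (ε / 2) (ENNReal.half_pos hε.ne')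
  obtain ⟨C', hC'⟩ := hG (ε / 2) (ENNReal.half_pos hε.ne')
  refine ⟨C + C', ?_⟩
  filter_upwards [hC, hC'] with n h1 h2
  calc P {ω | C + C' < ‖F n ω + G n ω‖}
      ≤ P ({ω | C < ‖F n ω‖} ∪ {ω | C' < ‖G n ω‖}) := by
        refine measure_mono fun ω hω => ?_
        by_contra hcon
        simp only [Set.mem_union, Set.mem_ofPred_eq, not_or, not_lt] at hcon hω
        exact absurd (hω.trans_le (norm_add_le _ _)) (not_lt.2 (add_le_add hcon.1 hcon.2))
    _ ≤ ε / 2 + ε / 2 := (measure_union_le _ _).trans (add_le_add h1 h2)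
    _ = ε := ENNReal.add_halves ε

lemma BoundedInProb.comp_tendsto [Norm E] {F : ℕ → Ω → E} (hF : BoundedInProb P F) {m : ℕ → ℕ}
    (hm : Tendsto m atTop atTop) : BoundedInProb P fun n => F (m n) := fun ε hε =>
  let ⟨C, hC⟩ := hF ε hε
  ⟨C, hm.eventually hC⟩

lemma BoundedInProb.zero [SeminormedAddCommGroup E] :
    BoundedInProb P fun (_ : ℕ) (_ : Ω) => (0 : E) :=
  fun ε _ => ⟨0, .of_forall fun _ => by simp⟩

lemma BoundedInProb.sum [SeminormedAddCommGroup E] {ι : Type*} (s : Finset ι)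
    {F : ι → ℕ → Ω → E} (hF : ∀ i ∈ s, BoundedInProb P (F i)) :
    BoundedInProb P fun n ω => ∑ i ∈ s, F i n ω := by
  classical
  induction s using Finset.induction_on with
  | empty => simpa using BoundedInProb.zero
  | insert a s ha ih =>
    simp only [Finset.sum_insert ha]
    exact (hF a (by simp)).add (ih fun i hi => hF i (by simp [hi]))

/-- The rule `o_P(1) · O_P(1) = o_P(1)`. -/
lemma BoundedInProb.tendsto_mul [SeminormedAddCommGroup E] {a : ℕ × Ω → ℝ} {G : ℕ → Ω → E}
    (hG : BoundedInProb P G) (ha : Tendsto a (inProb P) (𝓝 0)) :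
    Tendsto (fun x => a x * ‖G x.1 x.2‖) (inProb P) (𝓝 0) := by
  rw [Metric.tendsto_nhds]
  intro δ hδ
  refine (eventually_inProb (p := fun n ω => dist (a (n, ω) * ‖G n ω‖) 0 < δ)).2
    (ENNReal.tendsto_nhds_zero.2 fun ε hε => ?_)
  obtain ⟨C, hC⟩ := hG (ε / 2) (ENNReal.half_pos hε.ne')
  have hC1 : 0 < |C| + 1 := by positivity
  have h' := ENNReal.tendsto_nhds_zero.1
    ((eventually_inProb (p := fun n ω => dist (a (n, ω)) 0 < δ / (|C| + 1))).1
      (Metric.tendsto_nhds.1 ha _ (div_pos hδ hC1))) _ (ENNReal.half_pos hε.ne')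
  filter_upwards [hC, h'] with n h1 h2
  calc P {ω | ¬ dist (a (n, ω) * ‖G n ω‖) 0 < δ}
      ≤ P ({ω | C < ‖G n ω‖} ∪ {ω | ¬ dist (a (n, ω)) 0 < δ / (|C| + 1)}) := by
        refine measure_mono fun ω hω => ?_
        by_contra hcon
        simp only [Set.mem_union, Set.mem_ofPred_eq, not_or, not_lt] at hcon hω
        rw [dist_zero_right, Real.norm_eq_abs] at hcon
        rw [dist_zero_right, Real.norm_eq_abs, abs_mul] at hω
        rw [abs_of_nonneg (norm_nonneg _)] at hω
        have h3 : |a (n, ω)| * ‖G n ω‖ ≤ |a (n, ω)| * (|C| + 1) :=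
          mul_le_mul_of_nonneg_left (by linarith [hcon.1, le_abs_self C]) (abs_nonneg _)
        exact absurd (hω.trans h3) (not_le.2 ((lt_div_iff₀ hC1).1 (not_le.1 hcon.2)))
    _ ≤ ε / 2 + ε / 2 := (measure_union_le _ _).trans (add_le_add h1 h2)
    _ = ε := ENNReal.add_halves ε

lemma tendsto_inProb_of_ae [PseudoMetricSpace E] [IsFiniteMeasure P] {F : ℕ → Ω → E} {c : E}
    (hF : ∀ n, AEStronglyMeasurable (F n) P)
    (h : ∀ᵐ ω ∂P, Tendsto (fun n => F n ω) atTop (𝓝 c)) :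
    Tendsto (fun x => F x.1 x.2) (inProb P) (𝓝 c) :=
  tendsto_inProb_iff_tendstoInMeasure.2 (tendstoInMeasure_of_tendsto_ae hF h)

/-- If `F n` converges in distribution and `F n - G n → 0` in probability, then `G n` converges in
distribution to the same limit. -/
lemma tendstoInDistribution_of_tendsto_inProb_sub [IsProbabilityMeasure P] {F G : ℕ → Ω → ℝ}
    {κ : Measure ℝ} [IsProbabilityMeasure κ] (hF : TendstoInDistribution F atTop id (fun _ => P) κ)
    (hG : ∀ n, AEMeasurable (G n) P)
    (h : Tendsto (fun x => G x.1 x.2 - F x.1 x.2) (inProb P) (𝓝 0)) :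
    TendstoInDistribution G atTop id (fun _ => P) κ := by
  have h' : TendstoInMeasure P (G - F) atTop 0 :=
    (tendsto_inProb_iff_tendstoInMeasure (F := G - F) (c := (0 : ℝ))).1 h
  have := tendstoInDistribution_of_tendstoInMeasure_sub (X := F) (Y := G) (Z := (id : ℝ → ℝ))
    (l := atTop) (μ'' := P) (μ' := κ) hF h' hG
  exact this

end InProbability

/-! ### Sample means: law of large numbers, root-`m` boundedness, Markov bound. -/

section Sample

variable {Ω T E : Type*} [MeasurableSpace Ω] [MeasurableSpace T] {P : Measure Ω} {ν : Measure T}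
  {Z : ℕ → Ω → T}

/-- `Z 0, Z 1, …` are independent with common law `ν`. -/
structure IsIIDSample (P : Measure Ω) (ν : Measure T) (Z : ℕ → Ω → T) : Prop where
  measurable : ∀ i, Measurable (Z i)
  map_eq : ∀ i, P.map (Z i) = ν
  indep : iIndepFun Z P

/-- The average of `φ` over the first `m` observations. -/
def sampleMean [AddCommGroup E] [Module ℝ E] (Z : ℕ → Ω → T) (φ : T → E) (m : ℕ) (ω : Ω) : E :=
  (m : ℝ)⁻¹ • ∑ i ∈ Finset.range m, φ (Z i ω)

namespace IsIIDSample

lemma identDistrib (hZ : IsIIDSample P ν Z) (i : ℕ) : IdentDistrib (Z i) (Z 0) P P :=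
  ⟨(hZ.measurable i).aemeasurable, (hZ.measurable 0).aemeasurable,
    (hZ.map_eq i).trans (hZ.map_eq 0).symm⟩

lemma ae_forall (hZ : IsIIDSample P ν Z) {p : T → Prop} (hp : ∀ᵐ t ∂ν, p t) :
    ∀ᵐ ω ∂P, ∀ i, p (Z i ω) := by
  refine ae_all_iff.2 fun i => ?_
  rw [← hZ.map_eq i] at hp
  exact ae_of_ae_map (hZ.measurable i).aemeasurable hp

variable [NormedAddCommGroup E] {φ : T → E}

lemma aestronglyMeasurable_comp (hZ : IsIIDSample P ν Z) (hφ : AEStronglyMeasurable φ ν) (i : ℕ) :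
    AEStronglyMeasurable (fun ω => φ (Z i ω)) P := by
  rw [← hZ.map_eq i] at hφ
  exact hφ.comp_measurable (hZ.measurable i)

lemma integrable_comp (hZ : IsIIDSample P ν Z) (hφ : Integrable φ ν) (i : ℕ) :
    Integrable (fun ω => φ (Z i ω)) P := by
  rw [← hZ.map_eq i] at hφ
  exact hφ.comp_measurable (hZ.measurable i)

variable [NormedSpace ℝ E]

lemma integral_comp (hZ : IsIIDSample P ν Z) (hφ : AEStronglyMeasurable φ ν) (i : ℕ) :
    ∫ ω, φ (Z i ω) ∂P = ∫ t, φ t ∂ν := by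
  rw [← hZ.map_eq i] at hφ ⊢
  exact (integral_map (hZ.measurable i).aemeasurable hφ).symm

lemma aestronglyMeasurable_sampleMean (hZ : IsIIDSample P ν Z) (hφ : AEStronglyMeasurable φ ν)
    (m : ℕ) : AEStronglyMeasurable (sampleMean Z φ m) P :=
  (Finset.aestronglyMeasurable_fun_sum _ fun i _ =>
    hZ.aestronglyMeasurable_comp hφ i).const_smul _

/-- The law of large numbers along a sequence of sample sizes. -/
lemma tendsto_sampleMean [IsProbabilityMeasure P] [CompleteSpace E] [MeasurableSpace E]
    [BorelSpace E] (hZ : IsIIDSample P ν Z) (hφ : Integrable φ ν) {m : ℕ → ℕ}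
    (hm : Tendsto m atTop atTop) :
    Tendsto (fun x => sampleMean Z φ (m x.1) x.2) (inProb P) (𝓝 (∫ t, φ t ∂ν)) := by
  have hφm (i : ℕ) : AEMeasurable φ (P.map (Z i)) := by
    rw [hZ.map_eq i]; exact hφ.aestronglyMeasurable.aemeasurable
  have h := strong_law_ae (fun i ω => φ (Z i ω)) (hZ.integrable_comp hφ 0)
    (fun i j hij => (hZ.indep.indepFun hij).comp₀ (hZ.measurable i).aemeasurable
      (hZ.measurable j).aemeasurable (hφm i) (hφm j))
    (fun i => (hZ.identDistrib i).comp_of_aemeasurable (hφm i))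
  rw [hZ.integral_comp hφ.aestronglyMeasurable 0] at h
  exact (tendsto_inProb_of_ae (F := sampleMean Z φ)
    (hZ.aestronglyMeasurable_sampleMean hφ.aestronglyMeasurable) h).comp
    (tendsto_prodMap_inProb hm)

/-- `√m` times the mean of a centred square integrable function is bounded in probability. -/
lemma boundedInProb_sqrt_mul_sampleMean_real [IsProbabilityMeasure P] (hZ : IsIIDSample P ν Z)
    {U : T → ℝ} (hU : MemLp U 2 ν) (hU0 : ∫ t, U t ∂ν = 0) :
    BoundedInProb P fun m ω => √(m : ℝ) * sampleMean Z U m ω := by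
  have hUi (i : ℕ) : MemLp (fun ω => U (Z i ω)) 2 P := by
    have h := hU
    rw [← hZ.map_eq i] at h
    exact h.comp_of_map (hZ.measurable i).aemeasurable
  have hUm (i : ℕ) : AEMeasurable U (P.map (Z i)) := by
    rw [hZ.map_eq i]; exact hU.aestronglyMeasurable.aemeasurable
  set v := Var[fun ω => U (Z 0 ω); P]
  have hv (i : ℕ) : Var[fun ω => U (Z i ω); P] = v :=
    ((hZ.identDistrib i).comp_of_aemeasurable (hUm i)).variance_eq
  have hS (m : ℕ) : MemLp (fun ω => √(m : ℝ) * sampleMean Z U m ω) 2 P :=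
    MemLp.const_mul (f := sampleMean Z U m)
      ((memLp_finsetSum (Finset.range m) fun i _ => hUi i).const_smul (m : ℝ)⁻¹) _
  have hmean (m : ℕ) : ∫ ω, √(m : ℝ) * sampleMean Z U m ω ∂P = 0 := by
    simp only [sampleMean, smul_eq_mul, integral_const_mul]
    rw [integral_finsetSum _ fun i _ => (hUi i).integrable one_le_two]
    simp [hZ.integral_comp hU.aestronglyMeasurable, hU0]
  -- Equality holds except at `m = 0`, where the left side is `0`; a bound uniform in `m` is all
  -- that Chebyshev's inequality needs.
  have hvar (m : ℕ) : Var[fun ω => √(m : ℝ) * sampleMean Z U m ω; P] ≤ v := by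
    have hsum : Var[fun ω => ∑ i ∈ Finset.range m, U (Z i ω); P] = m * v := by
      have h := IndepFun.variance_sum (s := Finset.range m) (X := fun i ω => U (Z i ω))
        (fun i _ => hUi i) fun i _ j _ hij => (hZ.indep.indepFun hij).comp₀
          (hZ.measurable i).aemeasurable (hZ.measurable j).aemeasurable (hUm i) (hUm j)
      rw [show (fun ω => ∑ i ∈ Finset.range m, U (Z i ω)) =
        ∑ i ∈ Finset.range m, fun ω => U (Z i ω) by ext; simp, h]
      simp [hv]
    simp only [sampleMean, smul_eq_mul]
    rw [variance_const_mul, variance_const_mul, hsum, Real.sq_sqrt (Nat.cast_nonneg m)]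
    rcases Nat.eq_zero_or_pos m with rfl | hm
    · have hv0 : 0 ≤ v := variance_nonneg (fun ω => U (Z 0 ω)) P
      simpa using hv0
    · have : (m : ℝ) ≠ 0 := by positivity
      exact le_of_eq (by field_simp)
  intro ε hε
  have hlim : Tendsto (fun c : ℝ => ENNReal.ofReal (v / c ^ 2)) atTop (𝓝 0) := by
    have h : Tendsto (fun c : ℝ => v / c ^ 2) atTop (𝓝 0) :=
      tendsto_const_nhds.div_atTop (tendsto_pow_atTop two_ne_zero)
    simpa using ENNReal.tendsto_ofReal h
  obtain ⟨c, hc, hc0⟩ :=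
    ((ENNReal.tendsto_nhds_zero.1 hlim ε hε).and (eventually_gt_atTop 0)).exists
  refine ⟨c, .of_forall fun m => le_trans (measure_mono fun ω hω => ?_)
    ((meas_ge_le_variance_div_sq (hS m) hc0).trans
      ((ENNReal.ofReal_le_ofReal (by gcongr; exact hvar m)).trans hc))⟩
  simp only [Set.mem_ofPred_eq] at hω ⊢
  rw [hmean, sub_zero]
  exact hω.le

/-- Reduces to the real case: the norm is at most the sum of the absolute values of the finitely
many coordinates. -/
lemma boundedInProb_sqrt_smul_sampleMean [IsProbabilityMeasure P] {k : ℕ}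
    (hZ : IsIIDSample P ν Z) {U : T → EuclideanSpace ℝ (Fin k)} (hU : MemLp U 2 ν)
    (hU0 : ∫ t, U t ∂ν = 0) (hU1 : Integrable U ν) :
    BoundedInProb P fun m ω => √(m : ℝ) • sampleMean Z U m ω := by
  have hcoord (a : Fin k) : BoundedInProb P fun m ω =>
      ‖√(m : ℝ) * sampleMean Z (fun t => U t a) m ω‖ := by
    refine (hZ.boundedInProb_sqrt_mul_sampleMean_real (U := fun t => U t a) ?_ ?_).mono
      zero_le_one (.of_forall fun _ => by simp)
    · exact hU.continuousLinearMap_comp (EuclideanSpace.proj (𝕜 := ℝ) a)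
    · have h := (EuclideanSpace.proj (𝕜 := ℝ) a).integral_comp_comm hU1
      simpa [hU0] using h
  refine (BoundedInProb.sum Finset.univ fun a _ => hcoord a).mono zero_le_one
    (.of_forall fun x => ?_)
  rw [one_mul, Real.norm_of_nonneg (Finset.sum_nonneg fun _ _ => norm_nonneg _)]
  have hv (v : EuclideanSpace ℝ (Fin k)) : ‖v‖ ≤ ∑ a, ‖v a‖ := by
    calc ‖v‖ = ‖∑ a, v a • EuclideanSpace.basisFun (Fin k) ℝ a‖ := by
          congr 1
          simpa using ((EuclideanSpace.basisFun (Fin k) ℝ).sum_repr v).symm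
      _ ≤ ∑ a, ‖v a • EuclideanSpace.basisFun (Fin k) ℝ a‖ := norm_sum_le _ _
      _ = ∑ a, ‖v a‖ := by simp [norm_smul]
  refine (hv _).trans_eq (Finset.sum_congr rfl fun a _ => ?_)
  simp [sampleMean]

/-- Markov's inequality for sample means, which needs no independence. -/
lemma measure_sampleMean_ge_le [IsProbabilityMeasure P] (hZ : IsIIDSample P ν Z) {M : T → ℝ}
    (hM : Integrable M ν) (hM0 : 0 ≤ᵐ[ν] M) {ε : ℝ} (hε : 0 < ε) (m : ℕ) :
    P {ω | ε ≤ sampleMean Z M m ω} ≤ ENNReal.ofReal ((∫ t, M t ∂ν) / ε) := by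
  have hint : Integrable (sampleMean Z M m) P :=
    (integrable_finsetSum (Finset.range m) fun i _ => hZ.integrable_comp hM i).smul (m : ℝ)⁻¹
  have hnn : 0 ≤ᵐ[P] sampleMean Z M m := by
    filter_upwards [hZ.ae_forall hM0] with ω hω
    exact mul_nonneg (by positivity) (Finset.sum_nonneg fun i _ => hω i)
  have hle : ∫ ω, sampleMean Z M m ω ∂P ≤ ∫ t, M t ∂ν := by
    simp only [sampleMean, smul_eq_mul, integral_const_mul]
    rw [integral_finsetSum _ fun i _ => hZ.integrable_comp hM i]
    simp only [hZ.integral_comp hM.aestronglyMeasurable, Finset.sum_const, Finset.card_range,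
      nsmul_eq_mul, ← mul_assoc]
    rcases Nat.eq_zero_or_pos m with rfl | hm
    · simpa using integral_nonneg_of_ae hM0
    · rw [inv_mul_cancel₀ (by positivity), one_mul]
  rw [ENNReal.le_ofReal_iff_toReal_le (measure_ne_top _ _)
    (div_nonneg (integral_nonneg_of_ae hM0) hε.le), le_div_iff₀ hε, mul_comm]
  exact (mul_meas_ge_le_integral_of_nonneg hnn hint ε).trans hle

end IsIIDSample

end Sample

/-! ### Central limit theorem for means over nested samples. -/

section CentralLimit

/-- If `n (f n - 1) → t` and `m n / n → ρ`, then `f n ^ m n → exp (ρ t)`. -/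
lemma tendsto_pow_exp_of_ratio {f : ℕ → ℂ} {t : ℂ}
    (hf : Tendsto (fun n : ℕ => (n : ℂ) * (f n - 1)) atTop (𝓝 t)) {m : ℕ → ℕ} {ρ : ℝ}
    (hm : Tendsto (fun n : ℕ => (m n : ℝ) / n) atTop (𝓝 ρ)) :
    Tendsto (fun n => f n ^ m n) atTop (𝓝 (Complex.exp (ρ * t))) := by
  have hlog := Complex.tendsto_nat_mul_log_one_add_of_tendsto hf
  have hm' : Tendsto (fun n : ℕ => (((m n : ℝ) / n : ℝ) : ℂ)) atTop (𝓝 (ρ : ℂ)) :=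
    (Complex.continuous_ofReal.tendsto ρ).comp hm
  have hf1 : Tendsto f atTop (𝓝 1) := by
    have hinv : Tendsto (fun n : ℕ => ((n : ℂ))⁻¹) atTop (𝓝 0) := tendsto_inv_atTop_nhds_zero_nat
    have h := (hinv.mul hf).add_const 1
    rw [zero_mul, zero_add] at h
    refine h.congr' ?_
    filter_upwards [eventually_ne_atTop 0] with n hn
    have : (n : ℂ) ≠ 0 := by exact_mod_cast hn
    field_simp
    ring
  refine ((Complex.continuous_exp.tendsto _).comp (hm'.mul hlog)).congr' ?_
  -- Since `f n → 1`, eventually `f n ≠ 0` and `exp (log (f n)) = f n`; the power is then `exp ((m n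
  -- / n) · n log (f n))`.
  filter_upwards [eventually_ne_atTop 0, hf1.eventually_ne one_ne_zero] with n hn hfn
  have hn' : (n : ℂ) ≠ 0 := by exact_mod_cast hn
  simp only [Function.comp_apply, add_sub_cancel]
  push_cast
  rw [← mul_assoc, div_mul_cancel₀ _ hn', Complex.exp_nat_mul, Complex.exp_log hfn]

/-- Second order expansion at the origin of the characteristic function of a centred law. -/
lemma tendsto_mul_charFun_sub_one {ν : Measure ℝ} [IsProbabilityMeasure ν]
    (hν : MemLp id 2 ν) (h0 : ∫ x, x ∂ν = 0) (t : ℝ) :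
    Tendsto (fun n : ℕ => (n : ℂ) * (charFun ν ((√(n : ℝ))⁻¹ * t) - 1)) atTop
      (𝓝 (-(((∫ x, x ^ 2 ∂ν) * t ^ 2 / 2 : ℝ) : ℂ))) := by
  have hT (s : ℝ) : taylorWithinEval (charFun ν) 2 Set.univ 0 s =
      1 - ((∫ x, x ^ 2 ∂ν : ℝ) : ℂ) * s ^ 2 / 2 := by
    have h := taylorWithinEval_charFun_two_zero (P := ν) (X := id) (by fun_prop)
      (by simpa using hν) s
    simpa [h0] using h
  have hlo : (fun s : ℝ => charFun ν s - (1 - ((∫ x, x ^ 2 ∂ν : ℝ) : ℂ) * s ^ 2 / 2))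
      =o[𝓝 0] fun s => s ^ 2 := by
    simp_rw [← hT]
    have h := taylor_isLittleO_univ (x₀ := 0) (n := 2) (f := charFun ν) (contDiff_charFun hν)
    simpa using h
  have hs : Tendsto (fun n : ℕ => (√(n : ℝ))⁻¹ * t) atTop (𝓝 0) := by
    rw [← zero_mul t]
    exact .mul_const t (tendsto_inv_atTop_zero.comp <| Real.tendsto_sqrt_atTop.comp <|
      tendsto_natCast_atTop_atTop)
  have hlo' := hlo.comp_tendsto hs
  have hO : ((fun s : ℝ => s ^ 2) ∘ fun n : ℕ => (√(n : ℝ))⁻¹ * t) =O[atTop]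
      fun n : ℕ => ((n : ℂ))⁻¹ := by
    refine Asymptotics.IsBigO.of_bound (t ^ 2) (.of_forall fun n => ?_)
    rw [Function.comp_apply, mul_pow, inv_pow, Real.sq_sqrt (Nat.cast_nonneg n), norm_mul,
      mul_comm]
    simp
  have h1 := (Asymptotics.isBigO_refl (fun n : ℕ => (n : ℂ)) atTop).mul_isLittleO
    (show _ =o[atTop] fun n : ℕ => ((n : ℂ))⁻¹ from hlo'.trans_isBigO hO)
  have h2 : Tendsto (fun n : ℕ => (n : ℂ) * (charFun ν ((√(n : ℝ))⁻¹ * t) -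
      (1 - ((∫ x, x ^ 2 ∂ν : ℝ) : ℂ) * (((√(n : ℝ))⁻¹ * t : ℝ) : ℂ) ^ 2 / 2))) atTop (𝓝 0) := by
    refine (Asymptotics.isLittleO_one_iff ℝ).1 (h1.trans_isBigO ?_)
    refine Asymptotics.IsBigO.of_bound 1 (.of_forall fun n => ?_)
    rcases Nat.eq_zero_or_pos n with rfl | hn
    · simp
    · have hn' : (n : ℝ) ≠ 0 := by positivity
      simp [hn']
  have h3 := h2.add_const (-(((∫ x, x ^ 2 ∂ν) * t ^ 2 / 2 : ℝ) : ℂ))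
  rw [zero_add] at h3
  refine h3.congr' ?_
  filter_upwards [eventually_ne_atTop 0] with n hn
  have hn' : (n : ℂ) ≠ 0 := by exact_mod_cast hn
  have hsq : ((((√(n : ℝ))⁻¹ * t : ℝ) : ℂ)) ^ 2 = (n : ℂ)⁻¹ * t ^ 2 := by
    rw [← Complex.ofReal_pow, mul_pow, inv_pow, Real.sq_sqrt (Nat.cast_nonneg n)]
    push_cast
    rfl
  rw [hsq]
  push_cast
  field_simp
  ring

/-- The asymptotic variance of `√n` times the sum of a mean of `U` over a fraction `γ` of the sample
and the mean of `V` over the whole sample. -/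
def meanSumVar {T : Type*} [MeasurableSpace T] (ν : Measure T) (γ : ℝ) (U V : T → ℝ) : ℝ :=
  γ⁻¹ * ∫ t, U t ^ 2 ∂ν + 2 * ∫ t, U t * V t ∂ν + ∫ t, V t ^ 2 ∂ν

lemma meanSumVar_const_mul {T : Type*} [MeasurableSpace T] (ν : Measure T) (γ a : ℝ)
    (U V : T → ℝ) :
    meanSumVar ν γ (fun t => a * U t) (fun t => a * V t) = a ^ 2 * meanSumVar ν γ U V := by
  have h (t : T) : a * U t * (a * V t) = a ^ 2 * (U t * V t) := by ring
  simp only [meanSumVar, mul_pow, h, integral_const_mul]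
  ring

variable {Ω T : Type*} [MeasurableSpace Ω] [MeasurableSpace T] {P : Measure Ω}
  [IsProbabilityMeasure P] {ν : Measure T} {Z : ℕ → Ω → T}

/-- Central limit theorem for a sum in which the first `r n` terms are built from one function of
the observations and the remaining ones from another. -/
lemma IsIIDSample.tendstoInDistribution_two_blocks (hZ : IsIIDSample P ν Z) {A V : T → ℝ}
    (hA : MemLp A 2 ν) (hA0 : ∫ t, A t ∂ν = 0) (hV : MemLp V 2 ν) (hV0 : ∫ t, V t ∂ν = 0)
    {r : ℕ → ℕ} (hr : ∀ n, r n ≤ n) {γ : ℝ}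
    (hrγ : Tendsto (fun n : ℕ => (r n : ℝ) / n) atTop (𝓝 γ)) {v : NNReal}
    (hv : (v : ℝ) = γ * ∫ t, A t ^ 2 ∂ν + (1 - γ) * ∫ t, V t ^ 2 ∂ν) :
    TendstoInDistribution
      (fun (n : ℕ) ω => (√(n : ℝ))⁻¹ *
        ∑ i ∈ Finset.range n, if i < r n then A (Z i ω) else V (Z i ω))
      atTop (id : ℝ → ℝ) (fun _ => P) (gaussianReal 0 v) := by
  have hmeas (n i : ℕ) : AEMeasurable (fun ω => if i < r n then A (Z i ω) else V (Z i ω)) P := by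
    split_ifs
    · exact (hZ.aestronglyMeasurable_comp hA.aestronglyMeasurable i).aemeasurable
    · exact (hZ.aestronglyMeasurable_comp hV.aestronglyMeasurable i).aemeasurable
  have hlaw {B : T → ℝ} (hB : MemLp B 2 ν) (i : ℕ) :
      P.map (fun ω => B (Z i ω)) = ν.map B := by
    have hB' := hB.aestronglyMeasurable.aemeasurable
    rw [← hZ.map_eq i] at hB' ⊢
    exact (AEMeasurable.map_map_of_aemeasurable hB' (hZ.measurable i).aemeasurable).symm
  have : IsProbabilityMeasure ν := by
    rw [← hZ.map_eq 0]; exact Measure.isProbabilityMeasure_map (hZ.measurable 0).aemeasurable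
  have hlim {B : T → ℝ} (hB : MemLp B 2 ν) (hB0 : ∫ t, B t ∂ν = 0) (t : ℝ) :
      Tendsto (fun n : ℕ => (n : ℂ) * (charFun (ν.map B) ((√(n : ℝ))⁻¹ * t) - 1)) atTop
        (𝓝 (-(((∫ x, B x ^ 2 ∂ν) * t ^ 2 / 2 : ℝ) : ℂ))) := by
    have hB' := hB.aestronglyMeasurable.aemeasurable
    have : IsProbabilityMeasure (ν.map B) := Measure.isProbabilityMeasure_map hB'
    have h := tendsto_mul_charFun_sub_one (ν := ν.map B)
      ((memLp_map_measure_iff (by fun_prop) hB').2 hB)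
      (by rw [integral_map hB' (by fun_prop)]; exact hB0) t
    rwa [integral_map hB' (by fun_prop)] at h
  refine ⟨fun n => .const_mul (Finset.aemeasurable_fun_sum _ fun i _ => hmeas n i) _,
    by fun_prop, ?_⟩
  refine ProbabilityMeasure.tendsto_iff_tendsto_charFun.2 fun t => ?_
  have hchar (n : ℕ) : charFun (P.map fun ω => (√(n : ℝ))⁻¹ *
      ∑ i ∈ Finset.range n, if i < r n then A (Z i ω) else V (Z i ω)) t =
      charFun (ν.map A) ((√(n : ℝ))⁻¹ * t) ^ r n *
        charFun (ν.map V) ((√(n : ℝ))⁻¹ * t) ^ (n - r n) := by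
    have hind : iIndepFun (fun i ω => if i < r n then A (Z i ω) else V (Z i ω)) P := by
      have h := hZ.indep.comp₀ (fun i z => if i < r n then A z else V z)
        (fun i => (hZ.measurable i).aemeasurable) fun i => by
          rw [hZ.map_eq i]
          split_ifs
          exacts [hA.aestronglyMeasurable.aemeasurable, hV.aestronglyMeasurable.aemeasurable]
      exact h
    rw [charFun_map_mul_comp (Finset.aemeasurable_fun_sum _ fun i _ => hmeas n i),
      (hind.restrict _).charFun_map_fun_finsetSum_eq_prod (fun i _ => hmeas n i)]
    have hfac (i : ℕ) : charFun (P.map fun ω => if i < r n then A (Z i ω) else V (Z i ω))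
        ((√(n : ℝ))⁻¹ * t) = if i < r n then charFun (ν.map A) ((√(n : ℝ))⁻¹ * t)
          else charFun (ν.map V) ((√(n : ℝ))⁻¹ * t) := by
      split_ifs
      · rw [hlaw hA]
      · rw [hlaw hV]
    rw [Finset.prod_apply, Finset.prod_congr rfl fun i _ => hfac i]
    -- The product over the sample splits at `r n` into two powers, one for each law.
    obtain ⟨d, hd⟩ := Nat.exists_eq_add_of_le (hr n)
    rw [show Finset.range n = Finset.range (r n + d) by rw [← hd], Finset.prod_range_add]
    congr 1
    · rw [Finset.prod_congr rfl fun i hi => if_pos (Finset.mem_range.1 hi)]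
      simp
    · simp [show n - r n = d by omega]
  have hd : Tendsto (fun n : ℕ => ((n - r n : ℕ) : ℝ) / n) atTop (𝓝 (1 - γ)) := by
    refine (hrγ.const_sub 1).congr' ?_
    filter_upwards [eventually_ne_atTop 0] with n hn
    have hn' : (n : ℝ) ≠ 0 := by exact_mod_cast hn
    rw [Nat.cast_sub (hr n)]
    field_simp
  have hfin := (tendsto_pow_exp_of_ratio (hlim hA hA0 t) hrγ).mul
    (tendsto_pow_exp_of_ratio (hlim hV hV0 t) hd)
  rw [← Complex.exp_add] at hfin
  simp only [ProbabilityMeasure.coe_mk, hchar, Measure.map_id, charFun_gaussianReal]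
  convert! hfin using 3
  rw [← Complex.ofReal_neg]
  have : ((v : ℝ) : ℂ) =
      γ * ((∫ t, A t ^ 2 ∂ν : ℝ) : ℂ) + (1 - γ) * ((∫ t, V t ^ 2 ∂ν : ℝ) : ℂ) := by
    rw [hv]; push_cast; rfl
  rw [this]
  push_cast
  ring

/-- Central limit theorem for the sum of the mean of `U` over the first `r n` observations and the
mean of `V` over all `n` observations. -/
lemma IsIIDSample.tendstoInDistribution_two_means (hZ : IsIIDSample P ν Z) {U V : T → ℝ}
    (hU : MemLp U 2 ν) (hU0 : ∫ t, U t ∂ν = 0) (hV : MemLp V 2 ν) (hV0 : ∫ t, V t ∂ν = 0)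
    {r : ℕ → ℕ} (hr : ∀ n, r n ≤ n) {γ : ℝ} (hγ : 0 < γ)
    (hrγ : Tendsto (fun n : ℕ => (r n : ℝ) / n) atTop (𝓝 γ)) (hr_top : Tendsto r atTop atTop)
    (hγ1 : γ ≤ 1) :
    0 ≤ meanSumVar ν γ U V ∧ TendstoInDistribution
      (fun (n : ℕ) ω => √(n : ℝ) * (sampleMean Z U (r n) ω + sampleMean Z V n ω))
      atTop (id : ℝ → ℝ) (fun _ => P) (gaussianReal 0 (meanSumVar ν γ U V).toNNReal) := by
  have : IsProbabilityMeasure ν := by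
    rw [← hZ.map_eq 0]; exact Measure.isProbabilityMeasure_map (hZ.measurable 0).aemeasurable
  -- With `n / r n` replaced by its limit `γ⁻¹`, a labeled observation contributes `γ⁻¹ U + V` to
  -- `n` times the sum of means, and an unlabeled one contributes `V`.
  have hA : MemLp (fun t => γ⁻¹ * U t + V t) 2 ν := (hU.const_mul _).add hV
  have hUi := hU.integrable one_le_two
  have hVi := hV.integrable one_le_two
  have hA0 : ∫ t, (γ⁻¹ * U t + V t) ∂ν = 0 := by
    rw [integral_add (hUi.const_mul _) hVi, integral_const_mul, hU0, hV0]; simp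
  have hvar : meanSumVar ν γ U V =
      γ * ∫ t, (γ⁻¹ * U t + V t) ^ 2 ∂ν + (1 - γ) * ∫ t, V t ^ 2 ∂ν := by
    have hsq : ∫ t, (γ⁻¹ * U t + V t) ^ 2 ∂ν =
        γ⁻¹ ^ 2 * ∫ t, U t ^ 2 ∂ν + 2 * γ⁻¹ * ∫ t, U t * V t ∂ν + ∫ t, V t ^ 2 ∂ν := by
      have hUV : Integrable (fun t => U t * V t) ν := hU.integrable_mul hV
      rw [← integral_const_mul, ← integral_const_mul, ← integral_add, ← integral_add]
      · congr 1 with t; ring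
      · exact (hU.integrable_sq.const_mul _).add (hUV.const_mul _)
      · exact hV.integrable_sq
      · exact hU.integrable_sq.const_mul _
      · exact hUV.const_mul _
    rw [hsq, meanSumVar]
    field_simp
    ring
  have hnonneg : 0 ≤ meanSumVar ν γ U V := by
    rw [hvar]
    have h1 : 0 ≤ ∫ t, (γ⁻¹ * U t + V t) ^ 2 ∂ν := integral_nonneg fun _ => sq_nonneg _
    have h2 : 0 ≤ ∫ t, V t ^ 2 ∂ν := integral_nonneg fun _ => sq_nonneg _
    exact add_nonneg (mul_nonneg hγ.le h1) (mul_nonneg (sub_nonneg.2 hγ1) h2)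
  refine ⟨hnonneg, tendstoInDistribution_of_tendsto_inProb_sub
    (hZ.tendstoInDistribution_two_blocks hA hA0 hV hV0 hr hrγ
      ((Real.coe_toNNReal _ hnonneg).trans hvar)) (fun n => ?_) ?_⟩
  · exact (((hZ.aestronglyMeasurable_sampleMean hU.1 _).add
      (hZ.aestronglyMeasurable_sampleMean hV.1 _)).const_mul _).aemeasurable
  have hbdd := (hZ.boundedInProb_sqrt_mul_sampleMean_real hU hU0).comp_tendsto hr_top
  -- The cost of replacing `n / r n` by `γ⁻¹` is `√n (1 - (r/n)/γ)` times the mean of `U`. Written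
  -- as `(r/n)^{-1/2} (1 - (r/n)/γ)` times `√r` times that mean, it is `o(1) · O_P(1)`.
  have ha : Tendsto (fun n : ℕ => (√((r n : ℝ) / n))⁻¹ * (1 - (r n : ℝ) / n / γ)) atTop (𝓝 0) := by
    have h1 := ((Real.continuous_sqrt.tendsto γ).comp hrγ).inv₀ (Real.sqrt_pos.2 hγ).ne'
    have h2 := (hrγ.div_const γ).const_sub 1
    rw [div_self hγ.ne', sub_self] at h2
    simpa using h1.mul h2
  have hlim := (hbdd.tendsto_mul (ha.comp (tendsto_fst_inProb (P := P)))).norm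
  rw [norm_zero] at hlim
  rw [tendsto_zero_iff_norm_tendsto_zero]
  refine hlim.congr' ?_
  refine (eventually_inProb_of_eventually (P := P)
    ((eventually_gt_atTop 0).and (hr_top.eventually_gt_atTop 0))).mono ?_
  rintro ⟨n, ω⟩ ⟨hn, hrn⟩
  have hn' : (0 : ℝ) < n := by exact_mod_cast hn
  have hrn' : (0 : ℝ) < r n := by exact_mod_cast hrn
  have hsum : ∑ i ∈ Finset.range n, (if i < r n then γ⁻¹ * U (Z i ω) + V (Z i ω) else V (Z i ω)) =
      γ⁻¹ * (r n * sampleMean Z U (r n) ω) + n * sampleMean Z V n ω := by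
    have hite (i : ℕ) : (if i < r n then γ⁻¹ * U (Z i ω) + V (Z i ω) else V (Z i ω)) =
        (if i < r n then γ⁻¹ * U (Z i ω) else 0) + V (Z i ω) := by split_ifs <;> simp
    have hfilter : (Finset.range n).filter (· < r n) = Finset.range (r n) := by
      ext i
      have := hr n
      simp only [Finset.mem_filter, Finset.mem_range]
      omega
    simp only [hite, sampleMean, smul_eq_mul]
    rw [Finset.sum_add_distrib, ← Finset.sum_filter, hfilter, ← Finset.mul_sum,
      mul_inv_cancel_left₀ hn'.ne', mul_inv_cancel_left₀ hrn'.ne']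
  simp only [Function.comp_apply, hsum]
  rw [norm_mul, norm_norm, ← norm_mul]
  congr 1
  have h1 : √(n : ℝ) ≠ 0 := (Real.sqrt_pos.2 hn').ne'
  have h2 : √(r n : ℝ) ≠ 0 := (Real.sqrt_pos.2 hrn').ne'
  have h3 : √(n : ℝ) ^ 2 = n := Real.sq_sqrt hn'.le
  rw [Real.sqrt_div' _ hn'.le, inv_div]
  generalize sampleMean Z U (r n) ω = u
  generalize sampleMean Z V n ω = w
  rw [← h3] at hn' ⊢
  rw [Real.sqrt_sq (Real.sqrt_nonneg _)]
  field_simp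
  ring

end CentralLimit

/-! ### Local uniform domination of a family of functions. -/

section UniformBounds

variable {T E G : Type*} [MeasurableSpace T] {ν : Measure T} [PseudoMetricSpace E]
  [TopologicalSpace.SeparableSpace E] [NormedAddCommGroup G]

/-- A dominated family `F t θ` that tends to `0` as `θ → a` is bounded, near `a`, by an integrable
function of `t` with small integral. -/
lemma exists_integrable_bound_near {F : T → E → G} {S : Set E} {a : E} {H : T → ℝ}
    (hmeas : ∀ θ ∈ S, AEStronglyMeasurable (fun t => F t θ) ν)
    (hcont : ∀ᵐ t ∂ν, ContinuousOn (F t) S) (hlim : ∀ᵐ t ∂ν, Tendsto (F t) (𝓝[S] a) (𝓝 0))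
    (hbound : ∀ᵐ t ∂ν, ∀ θ ∈ S, ‖F t θ‖ ≤ H t) (hH : Integrable H ν) {ε : ℝ} (hε : 0 < ε) :
    ∃ δ > 0, ∃ M : T → ℝ, Integrable M ν ∧ 0 ≤ᵐ[ν] M ∧ ∫ t, M t ∂ν ≤ ε ∧
      ∀ᵐ t ∂ν, ∀ θ ∈ S ∩ Metric.ball a δ, ‖F t θ‖ ≤ M t := by
  have hpos (n : ℕ) : (0 : ℝ) < 1 / ((n : ℝ) + 1) := by positivity
  -- The supremum over a whole neighbourhood need not be measurable. A countable dense subset gives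
  -- a measurable supremum that, by continuity on `S`, still bounds every `F t θ`; dominated
  -- convergence as the radius shrinks then makes its integral small.
  choose D hDS hDc hDd using fun n : ℕ =>
    (TopologicalSpace.IsSeparable.of_separableSpace
      (S ∩ Metric.ball a (1 / ((n : ℝ) + 1)))).exists_countable_dense_subset
  let M (n : ℕ) (t : T) : ℝ≥0∞ := ⨆ θ ∈ D n, ‖F t θ‖ₑ
  have hM_meas (n : ℕ) : AEMeasurable (M n) ν :=
    AEMeasurable.biSup _ (hDc n) fun θ hθ => (hmeas θ (hDS n hθ).1).enorm
  have hM_ge (n : ℕ) : ∀ᵐ t ∂ν, ∀ θ ∈ S ∩ Metric.ball a (1 / ((n : ℝ) + 1)), ‖F t θ‖ₑ ≤ M n t := by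
    filter_upwards [hcont] with t ht θ hθ
    have hne : (𝓝[D n] θ).NeBot := mem_closure_iff_nhdsWithin_neBot.1 (hDd n hθ)
    have h1 : Tendsto (fun x => ‖F t x‖ₑ) (𝓝[D n] θ) (𝓝 ‖F t θ‖ₑ) :=
      ((ht θ hθ.1).mono fun x hx => (hDS n hx).1).enorm
    refine le_of_tendsto h1 ?_
    filter_upwards [self_mem_nhdsWithin] with x hx
    exact le_iSup₂ (f := fun θ (_ : θ ∈ D n) => ‖F t θ‖ₑ) x hx
  have hM_le (n : ℕ) : ∀ᵐ t ∂ν, M n t ≤ ENNReal.ofReal (H t) := by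
    filter_upwards [hbound] with t ht
    refine iSup₂_le fun θ hθ => ?_
    rw [← ofReal_norm]
    exact ENNReal.ofReal_le_ofReal (ht θ (hDS n hθ).1)
  have hM_lim : ∀ᵐ t ∂ν, Tendsto (fun n => M n t) atTop (𝓝 0) := by
    filter_upwards [hlim] with t ht
    refine ENNReal.tendsto_nhds_zero.2 fun η hη => ?_
    have h1 := ENNReal.tendsto_nhds_zero.1 (by simpa using ht.enorm) η hη
    obtain ⟨δ, hδ, hball⟩ := Metric.mem_nhdsWithin_iff.1 h1
    have h2 : ∀ᶠ n : ℕ in atTop, 1 / ((n : ℝ) + 1) < δ :=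
      tendsto_one_div_add_atTop_nhds_zero_nat.eventually_lt_const hδ
    filter_upwards [h2] with n hn
    refine iSup₂_le fun θ hθ => ?_
    exact hball ⟨Metric.ball_subset_ball hn.le (hDS n hθ).2, (hDS n hθ).1⟩
  have hfin : ∫⁻ t, ENNReal.ofReal (H t) ∂ν ≠ ∞ := hH.lintegral_lt_top.ne
  have hdct := tendsto_lintegral_of_dominated_convergence' _ hM_meas hM_le hfin hM_lim
  rw [lintegral_zero] at hdct
  obtain ⟨n, hn⟩ := (ENNReal.tendsto_nhds_zero.1 hdct _ (ENNReal.ofReal_pos.2 hε)).exists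
  have htop : ∀ᵐ t ∂ν, M n t < ∞ := (hM_le n).mono fun t ht => ht.trans_lt ENNReal.ofReal_lt_top
  refine ⟨_, hpos n, fun t => (M n t).toReal,
    integrable_toReal_of_lintegral_ne_top (hM_meas n) (hn.trans_lt ENNReal.ofReal_lt_top).ne,
    .of_forall fun _ => ENNReal.toReal_nonneg, ?_, ?_⟩
  · rw [integral_toReal (hM_meas n) htop]
    exact ENNReal.toReal_le_of_le_ofReal hε.le hn
  · filter_upwards [hM_ge n, htop] with t h1 h2 θ hθ
    rw [← toReal_enorm]
    exact ENNReal.toReal_mono h2.ne (h1 θ hθ)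

end UniformBounds

/-! ### Consistency of roots and expansions at random parameters. -/

section Sample

variable {Ω T E G : Type*} {Z : ℕ → Ω → T} [NormedAddCommGroup G] [NormedSpace ℝ G]

lemma norm_sampleMean_le (φ : T → G) (m : ℕ) (ω : Ω) :
    ‖sampleMean Z φ m ω‖ ≤ sampleMean Z (fun t => ‖φ t‖) m ω := by
  rw [sampleMean, sampleMean, norm_smul, Real.norm_of_nonneg (by positivity), smul_eq_mul]
  exact mul_le_mul_of_nonneg_left (norm_sum_le _ _) (by positivity)

lemma sampleMean_mono {φ χ : T → ℝ} {m : ℕ} {ω : Ω} (h : ∀ i, φ (Z i ω) ≤ χ (Z i ω)) :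
    sampleMean Z φ m ω ≤ sampleMean Z χ m ω :=
  mul_le_mul_of_nonneg_left (Finset.sum_le_sum fun i _ => h i) (by positivity)

lemma sampleMean_sub (φ χ : T → G) (m : ℕ) (ω : Ω) :
    sampleMean Z (fun t => φ t - χ t) m ω = sampleMean Z φ m ω - sampleMean Z χ m ω := by
  simp [sampleMean, Finset.sum_sub_distrib, smul_sub]

lemma ContinuousLinearMap.map_sampleMean {G' : Type*} [NormedAddCommGroup G'] [NormedSpace ℝ G']
    (L : G →L[ℝ] G') (φ : T → G) (m : ℕ) (ω : Ω) :
    L (sampleMean Z φ m ω) = sampleMean Z (fun t => L (φ t)) m ω := by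
  simp [sampleMean, map_sum]

namespace IsIIDSample

variable [MeasurableSpace Ω] [MeasurableSpace T] {P : Measure Ω} [IsProbabilityMeasure P]
  {ν : Measure T}

/-- First order expansion of a sample mean at a consistent estimator. -/
lemma eventually_norm_sampleMean_sub_le [NormedAddCommGroup E] [NormedSpace ℝ E]
    [SecondCountableTopology E] (hZ : IsIIDSample P ν Z) {F : T → E → G} {D : T → E →L[ℝ] G}
    {θ₀ : E} {δ₀ : ℝ} {L : T → ℝ} (hδ₀ : 0 < δ₀)
    (hmeas : ∀ θ ∈ Metric.ball θ₀ δ₀, AEStronglyMeasurable (fun t => F t θ) ν)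
    (hDmeas : AEStronglyMeasurable D ν) (hD : ∀ᵐ t ∂ν, HasFDerivAt (F t) (D t) θ₀)
    (hF : ∀ᵐ t ∂ν, ∀ θ ∈ Metric.ball θ₀ δ₀, DifferentiableAt ℝ (F t) θ ∧ ‖fderiv ℝ (F t) θ‖ ≤ L t)
    (hL : Integrable L ν) {θhat : ℕ → Ω → E}
    (hθ : Tendsto (fun x => θhat x.1 x.2) (inProb P) (𝓝 θ₀)) (m : ℕ → ℕ) {ε : ℝ} (hε : 0 < ε) :
    ∀ᶠ x in inProb P, ‖sampleMean Z (fun t => F t (θhat x.1 x.2)) (m x.1) x.2 -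
      sampleMean Z (fun t => F t θ₀) (m x.1) x.2 -
      sampleMean Z D (m x.1) x.2 (θhat x.1 x.2 - θ₀)‖ ≤ ε * ‖θhat x.1 x.2 - θ₀‖ := by
  -- The remainder divided by `‖θ - θ₀‖`. As `θhat` may depend on the very observations being
  -- averaged, `R` has to be bounded uniformly in `θ` near `θ₀`.
  let R (t : T) (θ : E) : G := ‖θ - θ₀‖⁻¹ • (F t θ - F t θ₀ - D t (θ - θ₀))
  have hθ₀ : θ₀ ∈ Metric.ball θ₀ δ₀ := Metric.mem_ball_self hδ₀
  have hRmeas : ∀ θ ∈ Metric.ball θ₀ δ₀ \ {θ₀}, AEStronglyMeasurable (fun t => R t θ) ν :=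
    fun θ hθ => (((hmeas θ hθ.1).sub (hmeas θ₀ hθ₀)).sub
      (hDmeas.apply_continuousLinearMap _)).const_smul _
  have hRcont : ∀ᵐ t ∂ν, ContinuousOn (R t) (Metric.ball θ₀ δ₀ \ {θ₀}) := by
    filter_upwards [hF] with t ht θ hθ
    have h1 := (ht θ hθ.1).1.continuousAt
    have h2 : ‖θ - θ₀‖ ≠ 0 := norm_ne_zero_iff.2 (sub_ne_zero.2 hθ.2)
    refine ContinuousAt.continuousWithinAt ?_
    refine ContinuousAt.smul (ContinuousAt.inv₀ (by fun_prop) h2) ?_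
    fun_prop
  have hRlim : ∀ᵐ t ∂ν, Tendsto (R t) (𝓝[Metric.ball θ₀ δ₀ \ {θ₀}] θ₀) (𝓝 0) := by
    filter_upwards [hD] with t ht
    have h := (hasFDerivAt_iff_tendsto.1 ht).mono_left
      (nhdsWithin_le_nhds (s := Metric.ball θ₀ δ₀ \ {θ₀}))
    rw [tendsto_zero_iff_norm_tendsto_zero]
    refine h.congr fun θ => ?_
    simp only [R]
    rw [norm_smul, norm_inv, norm_norm]
  -- One `L t` comes from the mean value inequality on the ball, the other from `‖D t‖ ≤ L t`.
  have hRbound : ∀ᵐ t ∂ν, ∀ θ ∈ Metric.ball θ₀ δ₀ \ {θ₀}, ‖R t θ‖ ≤ 2 * L t := by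
    filter_upwards [hF, hD] with t ht hDt θ hθ
    have h1 : ‖F t θ - F t θ₀‖ ≤ L t * ‖θ - θ₀‖ :=
      (convex_ball θ₀ δ₀).norm_image_sub_le_of_norm_fderiv_le (𝕜 := ℝ) (fun x hx => (ht x hx).1)
        (fun x hx => (ht x hx).2) hθ₀ hθ.1
    have h2 : ‖D t (θ - θ₀)‖ ≤ L t * ‖θ - θ₀‖ := by
      refine (ContinuousLinearMap.le_opNorm _ _).trans ?_
      gcongr
      rw [← hDt.fderiv]
      exact (ht θ₀ hθ₀).2
    have h3 : 0 < ‖θ - θ₀‖ := norm_pos_iff.2 (sub_ne_zero.2 hθ.2)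
    simp only [R]
    rw [norm_smul, norm_inv, norm_norm, inv_mul_le_iff₀ h3]
    exact (norm_sub_le _ _).trans (by linarith)
  refine (eventually_inProb (p := fun n ω => ‖sampleMean Z (fun t => F t (θhat n ω)) (m n) ω -
      sampleMean Z (fun t => F t θ₀) (m n) ω -
      sampleMean Z D (m n) ω (θhat n ω - θ₀)‖ ≤ ε * ‖θhat n ω - θ₀‖)).2
    (ENNReal.tendsto_nhds_zero.2 fun η hη => ?_)
  -- `c` is a real number below `η / 2`, which may be infinite. A majorant `M` with integral at most
  -- `c ε` has, by Markov, sample mean at least `ε` with probability at most `c`.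
  obtain ⟨c, hc0, hc⟩ : ∃ c : ℝ, 0 < c ∧ ENNReal.ofReal c ≤ η / 2 := by
    rcases eq_or_ne η ∞ with rfl | hη'
    · exact ⟨1, one_pos, by simp [ENNReal.top_div]⟩
    · refine ⟨(η / 2).toReal, ENNReal.toReal_pos (ENNReal.half_pos hη.ne').ne' ?_, ?_⟩
      · exact (ENNReal.div_lt_top hη' two_ne_zero).ne
      · exact ENNReal.ofReal_toReal_le
  obtain ⟨δ, hδ, M, hM, hM0, hMint, hMle⟩ := exists_integrable_bound_near hRmeas hRcont hRlim
    hRbound (hL.const_mul 2) (mul_pos hc0 hε)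
  have hnear : ∀ᶠ x in inProb P, θhat x.1 x.2 ∈ Metric.ball θ₀ δ ∩ Metric.ball θ₀ δ₀ :=
    hθ.eventually_mem (inter_mem (Metric.ball_mem_nhds _ hδ) (Metric.ball_mem_nhds _ hδ₀))
  have hnear' := ENNReal.tendsto_nhds_zero.1 ((eventually_inProb (p := fun n ω =>
    (∀ i, ∀ θ ∈ (Metric.ball θ₀ δ₀ \ {θ₀}) ∩ Metric.ball θ₀ δ, ‖R (Z i ω) θ‖ ≤ M (Z i ω)) ∧
      θhat n ω ∈ Metric.ball θ₀ δ ∩ Metric.ball θ₀ δ₀)).1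
    ((eventually_inProb_of_ae (.of_forall fun _ => hZ.ae_forall hMle)).and hnear)) _
      (ENNReal.half_pos hη.ne')
  filter_upwards [hnear'] with n hn
  calc _ ≤ P ({ω | ε ≤ sampleMean Z M (m n) ω} ∪ {ω | ¬ ((∀ i, ∀ θ ∈
        (Metric.ball θ₀ δ₀ \ {θ₀}) ∩ Metric.ball θ₀ δ, ‖R (Z i ω) θ‖ ≤ M (Z i ω)) ∧
      θhat n ω ∈ Metric.ball θ₀ δ ∩ Metric.ball θ₀ δ₀)}) := by
        refine measure_mono fun ω hω => ?_
        by_contra hcon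
        simp only [Set.mem_union, Set.mem_ofPred_eq, not_or, not_not, not_le] at hcon hω
        obtain ⟨hMε, hle, hb⟩ := hcon
        refine absurd hω (not_lt.2 ?_)
        rw [← sampleMean_sub]
        have hev : sampleMean Z D (m n) ω (θhat n ω - θ₀) =
            sampleMean Z (fun t => D t (θhat n ω - θ₀)) (m n) ω :=
          (ContinuousLinearMap.apply ℝ G (θhat n ω - θ₀)).map_sampleMean D (m n) ω
        rw [hev, ← sampleMean_sub]
        refine (norm_sampleMean_le _ _ _).trans ?_
        rcases eq_or_ne (θhat n ω) θ₀ with heq | hne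
        · simp [heq, sampleMean]
        have h3 : 0 < ‖θhat n ω - θ₀‖ := norm_pos_iff.2 (sub_ne_zero.2 hne)
        have h4 : sampleMean Z (fun t => ‖F t (θhat n ω) - F t θ₀ - D t (θhat n ω - θ₀)‖) (m n) ω ≤
            sampleMean Z (fun t => M t * ‖θhat n ω - θ₀‖) (m n) ω := by
          refine sampleMean_mono fun i => ?_
          have h5 := hle i _ ⟨⟨hb.2, hne⟩, hb.1⟩
          simp only [R] at h5
          rwa [norm_smul, norm_inv, norm_norm, inv_mul_le_iff₀ h3, mul_comm] at h5
        refine h4.trans ?_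
        have h6 : sampleMean Z (fun t => M t * ‖θhat n ω - θ₀‖) (m n) ω =
            sampleMean Z M (m n) ω * ‖θhat n ω - θ₀‖ := by
          simp [sampleMean, Finset.sum_mul, mul_assoc]
        rw [h6]
        gcongr
    _ ≤ η / 2 + η / 2 := by
        refine (measure_union_le _ _).trans (add_le_add ?_ hn)
        refine (hZ.measure_sampleMean_ge_le hM hM0 hε _).trans (le_trans ?_ hc)
        exact ENNReal.ofReal_le_ofReal ((div_le_iff₀ hε).2 hMint)
    _ = η := ENNReal.add_halves η

/-- Consistency of roots of estimating equations over a compact parameter set. -/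
lemma tendsto_root [PseudoMetricSpace E] [SecondCountableTopology E] [CompleteSpace G]
    [MeasurableSpace G] [BorelSpace G] (hZ : IsIIDSample P ν Z) {s : T → E → G} {Θ : Set E}
    (hΘ : IsCompact Θ) (hmeas : ∀ θ ∈ Θ, AEStronglyMeasurable (fun t => s t θ) ν)
    (hcont : ∀ᵐ t ∂ν, ContinuousOn (s t) Θ) {H : T → ℝ} (hH : Integrable H ν)
    (hbound : ∀ᵐ t ∂ν, ∀ θ ∈ Θ, ‖s t θ‖ ≤ H t) {θ₀ : E}
    (hid : ∀ θ ∈ Θ, ∫ t, s t θ ∂ν = 0 → θ = θ₀) {m : ℕ → ℕ} (hm : Tendsto m atTop atTop)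
    {θhat : ℕ → Ω → E} (hroot : ∀ᶠ x in inProb P, θhat x.1 x.2 ∈ Θ ∧
      sampleMean Z (fun t => s t (θhat x.1 x.2)) (m x.1) x.2 = 0) :
    Tendsto (fun x => θhat x.1 x.2) (inProb P) (𝓝 θ₀) := by
  rw [Metric.tendsto_nhds]
  intro ε hε
  have hK : IsCompact (Θ \ Metric.ball θ₀ ε) := hΘ.diff Metric.isOpen_ball
  suffices h : ∀ᶠ x in inProb P, ∀ θ ∈ Θ \ Metric.ball θ₀ ε,
      sampleMean Z (fun t => s t θ) (m x.1) x.2 ≠ 0 by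
    filter_upwards [h, hroot] with x h1 h2
    by_contra hcon
    exact h1 _ ⟨h2.1, hcon⟩ h2.2
  -- Away from `θ₀` the limiting equation has no root. Uniform control makes this stable on a small
  -- ball around each point, and compactness leaves finitely many balls.
  have hlocal : ∀ a ∈ Θ \ Metric.ball θ₀ ε, ∃ δ > 0, ∀ᶠ x in inProb P, ∀ θ ∈ Θ ∩ Metric.ball a δ,
      sampleMean Z (fun t => s t θ) (m x.1) x.2 ≠ 0 := by
    intro a ha
    have hsint : Integrable (fun t => s t a) ν :=
      hH.mono' (hmeas a ha.1) (hbound.mono fun t ht => ht a ha.1)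
    have hμ : 0 < ‖∫ t, s t a ∂ν‖ := by
      refine norm_pos_iff.2 fun h0 => ha.2 ?_
      rw [hid a ha.1 h0]
      exact Metric.mem_ball_self hε
    set μ := ‖∫ t, s t a ∂ν‖
    -- With `∫ M ≤ μ / 4`, the oscillation over the ball eventually averages below `μ / 2`, while
    -- the mean at `a` exceeds `μ / 2` in norm; so no root lies in the ball.
    obtain ⟨δ, hδ, M, hM, -, hMint, hMle⟩ := exists_integrable_bound_near (ν := ν)
      (F := fun t θ => s t θ - s t a) (S := Θ) (a := a) (H := fun t => 2 * H t)
      (fun θ hθ => (hmeas θ hθ).sub (hmeas a ha.1))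
      (hcont.mono fun t ht => ht.sub continuousOn_const)
      (hcont.mono fun t ht => by simpa using (ht a ha.1).tendsto.sub_const (s t a))
      (by
        filter_upwards [hbound] with t ht θ hθ
        exact (norm_sub_le _ _).trans (by linarith [ht θ hθ, ht a ha.1]))
      (hH.const_mul 2) (ε := μ / 4) (by positivity)
    refine ⟨δ, hδ, ?_⟩
    have h1 := (hZ.tendsto_sampleMean hM hm).eventually_lt_const
      (show ∫ t, M t ∂ν < μ / 2 by linarith)
    have h2 := (hZ.tendsto_sampleMean hsint hm).norm.eventually_const_lt
      (show μ / 2 < ‖∫ t, s t a ∂ν‖ by linarith)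
    have h3 := eventually_inProb_of_ae (P := P) (p := fun _ ω => ∀ i, ∀ θ ∈ Θ ∩ Metric.ball a δ,
      ‖s (Z i ω) θ - s (Z i ω) a‖ ≤ M (Z i ω)) (.of_forall fun _ => hZ.ae_forall hMle)
    filter_upwards [h1, h2, h3] with x h1 h2 h3 θ hθ h0
    have h4 : ‖sampleMean Z (fun t => s t θ - s t a) (m x.1) x.2‖ ≤ sampleMean Z M (m x.1) x.2 :=
      (norm_sampleMean_le _ _ _).trans (sampleMean_mono fun i => h3 i θ hθ)
    rw [sampleMean_sub, h0, zero_sub, norm_neg] at h4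
    linarith
  choose! δ hδ hloc using hlocal
  obtain ⟨A, hA, hcover⟩ := hK.elim_nhds_subcover (fun a => Metric.ball a (δ a))
    fun a ha => Metric.ball_mem_nhds a (hδ a ha)
  filter_upwards [(Filter.eventually_all_finset A).2 fun a ha => hloc a (hA a ha)] with x hx θ hθ
  obtain ⟨a, ha, hθa⟩ := Set.mem_iUnion₂.1 (hcover hθ)
  exact hx a ha θ ⟨hθ.1, hθa⟩

end IsIIDSample

end Sample

/-! ### Measurability of derivatives in a parameter. -/

section DerivativeMeasurability

variable {T G : Type*} [MeasurableSpace T] {ν : Measure T} [NormedAddCommGroup G] [NormedSpace ℝ G]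

/-- Each directional derivative is an almost everywhere limit of difference quotients, and `D` is a
finite combination of its values on the standard basis. Applied twice, to `g` and then to `grad g`,
it yields the Hessian. -/
lemma aestronglyMeasurable_of_hasFDerivAt {k : ℕ} {F : T → EuclideanSpace ℝ (Fin k) → G}
    {D : T → EuclideanSpace ℝ (Fin k) →L[ℝ] G} {θ₀ : EuclideanSpace ℝ (Fin k)}
    (hF : ∀ᶠ θ in 𝓝 θ₀, AEStronglyMeasurable (fun t => F t θ) ν)
    (hD : ∀ᵐ t ∂ν, HasFDerivAt (F t) (D t) θ₀) : AEStronglyMeasurable D ν := by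
  have happ (u : EuclideanSpace ℝ (Fin k)) : AEStronglyMeasurable (fun t => D t u) ν := by
    have hseq : Tendsto (fun n : ℕ => θ₀ + ((n : ℝ))⁻¹ • u) atTop (𝓝 θ₀) := by
      have h := (tendsto_inv_atTop_nhds_zero_nat (𝕜 := ℝ)).smul_const u
      simpa using h.const_add θ₀
    obtain ⟨N, hN⟩ := (hseq.eventually hF).exists_forall_of_atTop
    -- The shift by `N` puts every evaluation point in the region where `F · θ` is measurable.
    refine aestronglyMeasurable_of_tendsto_ae (u := atTop)
      (f := fun (n : ℕ) t => ((n + N : ℕ) : ℝ) •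
        (F t (θ₀ + (((n + N : ℕ) : ℝ))⁻¹ • u) - F t θ₀)) ?_ ?_
    · exact fun n => ((hN (n + N) (Nat.le_add_left _ _)).sub hF.self_of_nhds).const_smul _
    · filter_upwards [hD] with t ht
      refine ht.lim u ?_
      simp only [Real.norm_natCast]
      exact tendsto_natCast_atTop_atTop.comp (tendsto_add_atTop_nat N)
  have hsum : D = fun t => ∑ a, ContinuousLinearMap.smulRightL ℝ _ G
      (EuclideanSpace.proj (𝕜 := ℝ) a) (D t (EuclideanSpace.basisFun (Fin k) ℝ a)) := by
    ext t u
    conv_lhs => rw [← (EuclideanSpace.basisFun (Fin k) ℝ).sum_repr u]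
    simp [map_sum]
  rw [hsum]
  exact Finset.aestronglyMeasurable_fun_sum _ fun a _ =>
    (ContinuousLinearMap.continuous _).comp_aestronglyMeasurable (happ _)

end DerivativeMeasurability

/-! ### The score, its derivative, and their bounds. -/

namespace SubclassEstimation

variable {f k : ℕ} {g : Feature f → Param k → ℝ} {t : Feature f} {θ : Param k}

/-- The rank one operator `u ↦ ⟪v, u⟫ v`. -/
def rankOne (v : Param k) : Param k →L[ℝ] Param k := (innerSL ℝ v).smulRight v

lemma rankOne_apply (v u : Param k) : rankOne v u = ⟪v, u⟫ • v := rfl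

lemma norm_rankOne (v : Param k) : ‖rankOne v‖ = ‖v‖ ^ 2 := by
  rw [rankOne, ContinuousLinearMap.norm_smulRight_apply, innerSL_apply_norm, sq]

lemma continuous_rankOne : Continuous (rankOne : Param k → _) := by
  have h : (rankOne : Param k → _) = fun v =>
      ContinuousLinearMap.smulRightL ℝ (Param k) (Param k) (innerSL ℝ v) v := rfl
  rw [h]
  fun_prop

/-- The operator `w g' g'ᵀ`. -/
def infoOp (g : Feature f → Param k → ℝ) (θ : Param k) (t : Feature f) :
    Param k →L[ℝ] Param k := weight g t θ • rankOne (grad g t θ)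

/-- The coefficient of the residual `y - g` in the derivative of the score. -/
def residualOp (g : Feature f → Param k → ℝ) (θ : Param k) (t : Feature f) :
    Param k →L[ℝ] Param k :=
  weight g t θ • hess g t θ -
    ((1 - 2 * g t θ) * weight g t θ ^ 2) • rankOne (grad g t θ)

/-- The derivative of the score in the parameter. -/
def scoreDeriv (g : Feature f → Param k → ℝ) (θ : Param k) (z : Feature f × ℝ) :
    Param k →L[ℝ] Param k :=
  (z.2 - g z.1 θ) • residualOp g θ z.1 - infoOp g θ z.1

lemma hasFDerivAt_innerSL_grad (hg : ContDiffAt ℝ 2 (g t) θ) :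
    HasFDerivAt (g t) (innerSL ℝ (grad g t θ)) θ :=
  (hg.differentiableAt (by norm_num)).hasGradientAt.hasFDerivAt

lemma hasFDerivAt_grad (hg : ContDiffAt ℝ 2 (g t) θ) :
    HasFDerivAt (grad g t) (hess g t θ) θ := by
  have h : DifferentiableAt ℝ (fderiv ℝ (g t)) θ :=
    (hg.fderiv_right (m := 1) (by norm_num)).differentiableAt (by norm_num)
  exact ((InnerProductSpace.toDual ℝ (Param k)).symm.differentiable.differentiableAt.comp θ
    h).hasFDerivAt

lemma weight_pos (h : g t θ ∈ Set.Ioo (0 : ℝ) 1) : 0 < weight g t θ :=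
  one_div_pos.2 (mul_pos h.1 (sub_pos.2 h.2))

lemma one_le_weight (h : g t θ ∈ Set.Ioo (0 : ℝ) 1) : 1 ≤ weight g t θ := by
  rw [weight, le_div_iff₀ (mul_pos h.1 (sub_pos.2 h.2))]
  nlinarith [h.1, h.2]

lemma weight_mul (h : g t θ ∈ Set.Ioo (0 : ℝ) 1) : weight g t θ * (g t θ * (1 - g t θ)) = 1 :=
  one_div_mul_cancel (mul_pos h.1 (sub_pos.2 h.2)).ne'

/-- From `w = 1 / (g (1 - g))` one gets `w' = -(1 - 2g) w² g'`. Differentiating the residual gives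
`-w g' g'ᵀ`; every other term keeps the factor `y - g`, and so integrates to zero at the true
parameter. -/
lemma hasFDerivAt_score (h : g t θ ∈ Set.Ioo (0 : ℝ) 1) (hg : ContDiffAt ℝ 2 (g t) θ) (y : ℝ) :
    HasFDerivAt (score g t y) (scoreDeriv g θ (t, y)) θ := by
  have h1 := hasFDerivAt_innerSL_grad hg
  have hne : g t θ * (1 - g t θ) ≠ 0 := (mul_pos h.1 (sub_pos.2 h.2)).ne'
  have hw : HasFDerivAt (weight g t)
      ((-((1 - 2 * g t θ) * weight g t θ ^ 2)) • innerSL ℝ (grad g t θ)) θ := by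
    have h2 := (hasDerivAt_inv hne).comp_hasFDerivAt θ (h1.mul (h1.const_sub 1))
    have h3 : weight g t = fun θ => (g t θ * (1 - g t θ))⁻¹ := by
      ext; simp [weight]
    rw [h3]
    refine h2.congr_fderiv ?_
    ext u
    simp
    field_simp
    ring
  refine ((hw.mul (h1.const_sub y)).smul (hasFDerivAt_grad hg)).congr_fderiv ?_
  ext1 u
  simp only [scoreDeriv, residualOp, infoOp, add_apply,
    smul_apply, sub_apply, rankOne_apply,
    ContinuousLinearMap.smulRight_apply, neg_apply, innerSL_apply_apply]
  simp only [Pi.mul_apply, smul_eq_mul]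
  module

/-- Since `w ≥ 1`, the single weight in `w ‖g'‖²` is at most `w²`, so the bound on `(w ‖g'‖)²`
suffices. -/
lemma norm_infoOp_le (h : g t θ ∈ Set.Ioo (0 : ℝ) 1) {H : ℝ}
    (h1 : (weight g t θ * ‖grad g t θ‖) ^ 2 ≤ H) : ‖infoOp g θ t‖ ≤ H := by
  have hw := one_le_weight h
  rw [infoOp, norm_smul, norm_rankOne, Real.norm_of_nonneg (weight_pos h).le]
  refine le_trans ?_ h1
  rw [mul_pow]
  gcongr
  nlinarith

lemma norm_residualOp_le (h : g t θ ∈ Set.Ioo (0 : ℝ) 1) {H : ℝ}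
    (h1 : (weight g t θ * ‖grad g t θ‖) ^ 2 ≤ H) (h2 : weight g t θ * ‖hess g t θ‖ ≤ H) :
    ‖residualOp g θ t‖ ≤ 2 * H := by
  have hw := weight_pos h
  have habs : |1 - 2 * g t θ| ≤ 1 := abs_le.2 ⟨by linarith [h.2], by linarith [h.1]⟩
  refine (norm_sub_le _ _).trans ?_
  rw [norm_smul, norm_smul, norm_rankOne, norm_mul, Real.norm_of_nonneg hw.le,
    Real.norm_of_nonneg (sq_nonneg _), Real.norm_eq_abs, mul_assoc, ← mul_pow]
  nlinarith [sq_nonneg (weight g t θ * ‖grad g t θ‖), abs_nonneg (1 - 2 * g t θ)]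

lemma abs_sub_le_one (h : g t θ ∈ Set.Ioo (0 : ℝ) 1) {y : ℝ} (hy : y = 0 ∨ y = 1) :
    |y - g t θ| ≤ 1 := by
  rcases hy with rfl | rfl
  · exact abs_le.2 ⟨by linarith [h.2], by linarith [h.1]⟩
  · exact abs_le.2 ⟨by linarith [h.2], by linarith [h.1]⟩

lemma norm_scoreDeriv_le (h : g t θ ∈ Set.Ioo (0 : ℝ) 1) {y : ℝ} (hy : y = 0 ∨ y = 1) {H : ℝ}
    (h1 : (weight g t θ * ‖grad g t θ‖) ^ 2 ≤ H) (h2 : weight g t θ * ‖hess g t θ‖ ≤ H) :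
    ‖scoreDeriv g θ (t, y)‖ ≤ 3 * H := by
  refine (norm_sub_le _ _).trans ?_
  rw [norm_smul, Real.norm_eq_abs]
  have h3 := norm_infoOp_le h h1
  have h4 := norm_residualOp_le h h1 h2
  nlinarith [abs_sub_le_one h hy, abs_nonneg (y - g t θ), norm_nonneg (residualOp g θ t)]

lemma norm_score_le (h : g t θ ∈ Set.Ioo (0 : ℝ) 1) {y : ℝ} (hy : y = 0 ∨ y = 1) :
    ‖score g t y θ‖ ≤ weight g t θ * ‖grad g t θ‖ := by
  rw [score, norm_smul, norm_mul, Real.norm_of_nonneg (weight_pos h).le, Real.norm_eq_abs]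
  gcongr
  exact mul_le_of_le_one_right (weight_pos h).le (abs_sub_le_one h hy)

lemma norm_grad_le (h : g t θ ∈ Set.Ioo (0 : ℝ) 1) :
    ‖grad g t θ‖ ≤ weight g t θ * ‖grad g t θ‖ :=
  le_mul_of_one_le_left (norm_nonneg _) (one_le_weight h)

lemma continuousAt_score (h : g t θ ∈ Set.Ioo (0 : ℝ) 1) (hg : ContDiffAt ℝ 2 (g t) θ) (y : ℝ) :
    ContinuousAt (score g t y) θ :=
  (hasFDerivAt_score h hg y).continuousAt

section Measurability

variable {μ : Measure (Feature f)} {Θ : Set (Param k)}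

lemma RegularFamily.measurable_apply (hreg : RegularFamily μ g Θ) (θ : Param k) :
    Measurable fun t => g t θ :=
  hreg.measurable.comp (measurable_id.prodMk measurable_const)

lemma RegularFamily.measurable_weight (hreg : RegularFamily μ g Θ) (θ : Param k) :
    Measurable fun t => weight g t θ := by
  have := hreg.measurable_apply θ
  unfold weight
  fun_prop

lemma RegularFamily.aestronglyMeasurable_grad (hreg : RegularFamily μ g Θ) (hθ : θ ∈ Θ) :
    AEStronglyMeasurable (fun t => grad g t θ) μ := by
  have h : AEStronglyMeasurable (fun t => fderiv ℝ (g t) θ) μ :=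
    aestronglyMeasurable_of_hasFDerivAt
      (.of_forall fun θ' => (hreg.measurable_apply θ').aestronglyMeasurable)
      (hreg.contDiffAt.mono fun t ht => ((ht θ hθ).differentiableAt (by norm_num)).hasFDerivAt)
  exact (InnerProductSpace.toDual ℝ (Param k)).symm.continuous.comp_aestronglyMeasurable h

lemma RegularFamily.aestronglyMeasurable_hess (hreg : RegularFamily μ g Θ)
    (hθ : θ ∈ interior Θ) : AEStronglyMeasurable (fun t => hess g t θ) μ := by
  refine aestronglyMeasurable_of_hasFDerivAt (F := grad g) ?_
    (hreg.contDiffAt.mono fun t ht => hasFDerivAt_grad (ht θ (interior_subset hθ)))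
  filter_upwards [mem_interior_iff_mem_nhds.1 hθ] with θ' hθ'
  exact hreg.aestronglyMeasurable_grad hθ'

lemma RegularFamily.aestronglyMeasurable_infoOp (hreg : RegularFamily μ g Θ) (hθ : θ ∈ Θ) :
    AEStronglyMeasurable (infoOp g θ) μ :=
  (hreg.measurable_weight θ).aestronglyMeasurable.smul
    (continuous_rankOne.comp_aestronglyMeasurable (hreg.aestronglyMeasurable_grad hθ))

lemma RegularFamily.aestronglyMeasurable_residualOp (hreg : RegularFamily μ g Θ)
    (hθ : θ ∈ interior Θ) : AEStronglyMeasurable (residualOp g θ) μ := by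
  have h1 := hreg.measurable_apply θ
  have h2 := hreg.measurable_weight θ
  have h3 : AEStronglyMeasurable (fun t => (1 - 2 * g t θ) * weight g t θ ^ 2) μ :=
    Measurable.aestronglyMeasurable (by fun_prop)
  exact (h2.aestronglyMeasurable.smul (hreg.aestronglyMeasurable_hess hθ)).sub
    (h3.smul (continuous_rankOne.comp_aestronglyMeasurable
      (hreg.aestronglyMeasurable_grad (interior_subset hθ))))

end Measurability

end SubclassEstimation

/-- The comparison itself. Orthogonality removes all cross terms except `E AQ`, which enters both
variances as `-2 E AQ` and cancels, as does `E Q²`. What is left is `(γ⁻¹ - 1) E A² + γ⁻¹ (E R² - E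
S²)`, and `E RS = E S²` is Pythagoras: `E R² - E S² = E (R - S)²`. -/
lemma meanSumVar_sub_meanSumVar {T : Type*} [MeasurableSpace T] {ν : Measure T} (γ : ℝ)
    {A R Q S : T → ℝ} (hA : MemLp A 2 ν) (hR : MemLp R 2 ν) (hQ : MemLp Q 2 ν) (hS : MemLp S 2 ν)
    (hRA : ∫ t, R t * A t ∂ν = 0) (hRQ : ∫ t, R t * Q t ∂ν = 0) (hSA : ∫ t, S t * A t ∂ν = 0)
    (hSQ : ∫ t, S t * Q t ∂ν = 0) (hRS : ∫ t, R t * S t ∂ν = ∫ t, S t ^ 2 ∂ν) :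
    meanSumVar ν γ (fun t => A t + R t) (fun t => -Q t) -
        meanSumVar ν γ S (fun t => A t - Q t) =
      (γ⁻¹ - 1) * ∫ t, A t ^ 2 ∂ν + γ⁻¹ * ∫ t, (R t - S t) ^ 2 ∂ν := by
  have iRA : Integrable (fun t => R t * A t) ν := hR.integrable_mul hA
  have iRQ : Integrable (fun t => R t * Q t) ν := hR.integrable_mul hQ
  have iSA : Integrable (fun t => S t * A t) ν := hS.integrable_mul hA
  have iSQ : Integrable (fun t => S t * Q t) ν := hS.integrable_mul hQ
  have iRS : Integrable (fun t => R t * S t) ν := hR.integrable_mul hS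
  have iAQ : Integrable (fun t => A t * Q t) ν := hA.integrable_mul hQ
  have iA := hA.integrable_sq
  have iR := hR.integrable_sq
  have iQ := hQ.integrable_sq
  have iS := hS.integrable_sq
  have iAR : Integrable (fun t => A t ^ 2 + R t ^ 2) ν := iA.add iR
  have iAQ' : Integrable (fun t => -(A t * Q t)) ν := iAQ.neg
  have iAQ2 : Integrable (fun t => A t ^ 2 - 2 * (A t * Q t)) ν := iA.sub (iAQ.const_mul 2)
  have iRS2 : Integrable (fun t => R t ^ 2 - 2 * (R t * S t)) ν := iR.sub (iRS.const_mul 2)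
  have h1 : ∫ t, (A t + R t) ^ 2 ∂ν = ∫ t, A t ^ 2 ∂ν + ∫ t, R t ^ 2 ∂ν := by
    rw [show (fun t => (A t + R t) ^ 2) = fun t => A t ^ 2 + R t ^ 2 + 2 * (R t * A t) by
      ext; ring, integral_add iAR (iRA.const_mul 2), integral_add iA iR,
      integral_const_mul, hRA]
    ring
  have h2 : ∫ t, (A t + R t) * -Q t ∂ν = -∫ t, A t * Q t ∂ν := by
    rw [show (fun t => (A t + R t) * -Q t) = fun t => -(A t * Q t) - R t * Q t by ext; ring,
      integral_sub iAQ' iRQ, integral_neg, hRQ, sub_zero]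
  have h3 : ∫ t, S t * (A t - Q t) ∂ν = 0 := by
    simp only [mul_sub]
    rw [integral_sub iSA iSQ, hSA, hSQ, sub_zero]
  have h4 : ∫ t, (A t - Q t) ^ 2 ∂ν =
      ∫ t, A t ^ 2 ∂ν - 2 * ∫ t, A t * Q t ∂ν + ∫ t, Q t ^ 2 ∂ν := by
    rw [show (fun t => (A t - Q t) ^ 2) = fun t => A t ^ 2 - 2 * (A t * Q t) + Q t ^ 2 by
      ext; ring, integral_add iAQ2 iQ, integral_sub iA (iAQ.const_mul 2),
      integral_const_mul]
  have h5 : ∫ t, (R t - S t) ^ 2 ∂ν = ∫ t, R t ^ 2 ∂ν - ∫ t, S t ^ 2 ∂ν := by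
    rw [show (fun t => (R t - S t) ^ 2) = fun t => R t ^ 2 - 2 * (R t * S t) + S t ^ 2 by
      ext; ring, integral_add iRS2 iS, integral_sub iR (iRS.const_mul 2),
      integral_const_mul, hRS]
    ring
  simp only [meanSumVar, h1, h2, h3, h4, h5, neg_sq]
  ring

/-! ### Moment identities for binary regression. -/

namespace SubclassEstimation

variable {f k : ℕ}

/-- A law `ν` of pairs `(X, Y)` with binary `Y` and regression function `g(·, θ₀)`, where `g` is a
regular family on a neighbourhood `Θ` of `θ₀`. -/
structure BinaryRegression (ν : Measure (Feature f × ℝ)) (g : Feature f → Param k → ℝ)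
    (Θ : Set (Param k)) (θ₀ : Param k) : Prop where
  prob : IsProbabilityMeasure ν
  binary : ∀ᵐ z ∂ν, z.2 = 0 ∨ z.2 = 1
  residual : ∀ h : Feature f → ℝ, Integrable h (ν.map Prod.fst) →
    ∫ z, (z.2 - g z.1 θ₀) * h z.1 ∂ν = 0
  mem_interior : θ₀ ∈ interior Θ
  regular : RegularFamily (ν.map Prod.fst) g Θ

/-- The population information operator `E[w g' g'ᵀ]`. -/
def meanInfoOp (ν : Measure (Feature f × ℝ)) (g : Feature f → Param k → ℝ) (θ : Param k) :
    Param k →L[ℝ] Param k := ∫ z, infoOp g θ z.1 ∂ν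

/-- The gradient `E[I_W g']` of the subclass mean. -/
def subclassGrad (ν : Measure (Feature f × ℝ)) (g : Feature f → Param k → ℝ) (θ : Param k)
    (W : Set (Feature f)) : Param k := ∫ z, ind W z.1 • grad g z.1 θ ∂ν

lemma measurable_ind {W : Set (Feature f)} (hW : MeasurableSet W) : Measurable (ind W) :=
  measurable_const.indicator hW

lemma ind_eq_zero_or_one (W : Set (Feature f)) (t : Feature f) : ind W t = 0 ∨ ind W t = 1 := by
  by_cases h : t ∈ W <;> simp [ind, h]

lemma abs_ind_le_one (W : Set (Feature f)) (t : Feature f) : |ind W t| ≤ 1 := by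
  rcases ind_eq_zero_or_one W t with h | h <;> simp [h]

namespace BinaryRegression

variable {ν : Measure (Feature f × ℝ)} {g : Feature f → Param k → ℝ} {Θ : Set (Param k)}
  {θ₀ : Param k} {W : Set (Feature f)}

lemma mem (hM : BinaryRegression ν g Θ θ₀) : θ₀ ∈ Θ := interior_subset hM.mem_interior

lemma ae_fst {p : Feature f → Prop} (h : ∀ᵐ t ∂(ν.map Prod.fst), p t) : ∀ᵐ z ∂ν, p z.1 :=
  ae_of_ae_map measurable_fst.aemeasurable h

/-- The almost sure regularity properties, with a common dominating function. -/
lemma exists_dominating (hM : BinaryRegression ν g Θ θ₀) :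
    ∃ H : Feature f × ℝ → ℝ, Integrable H ν ∧ ∀ᵐ z ∂ν, (z.2 = 0 ∨ z.2 = 1) ∧ ∀ θ ∈ Θ,
      g z.1 θ ∈ Set.Ioo (0 : ℝ) 1 ∧ ContDiffAt ℝ 2 (g z.1) θ ∧
      (weight g z.1 θ * ‖grad g z.1 θ‖) ^ 2 ≤ H z ∧ weight g z.1 θ * ‖hess g z.1 θ‖ ≤ H z := by
  obtain ⟨H, hH, hdom⟩ := hM.regular.dominated
  refine ⟨fun z => H z.1, hH.comp_measurable measurable_fst, ?_⟩
  filter_upwards [hM.binary, ae_fst hM.regular.mem_Ioo, ae_fst hM.regular.contDiffAt,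
    ae_fst hdom] with z h1 h2 h3 h4
  exact ⟨h1, fun θ hθ => ⟨h2 θ hθ, h3 θ hθ, h4 θ hθ⟩⟩

lemma aestronglyMeasurable_grad (hM : BinaryRegression ν g Θ θ₀) {θ : Param k} (hθ : θ ∈ Θ) :
    AEStronglyMeasurable (fun z : Feature f × ℝ => grad g z.1 θ) ν :=
  (hM.regular.aestronglyMeasurable_grad hθ).comp_measurable measurable_fst

lemma measurable_g (hM : BinaryRegression ν g Θ θ₀) (θ : Param k) :
    Measurable fun z : Feature f × ℝ => g z.1 θ :=
  (hM.regular.measurable_apply θ).comp measurable_fst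

lemma measurable_weight (hM : BinaryRegression ν g Θ θ₀) (θ : Param k) :
    Measurable fun z : Feature f × ℝ => weight g z.1 θ :=
  (hM.regular.measurable_weight θ).comp measurable_fst

lemma aestronglyMeasurable_score (hM : BinaryRegression ν g Θ θ₀) {θ : Param k} (hθ : θ ∈ Θ) :
    AEStronglyMeasurable (fun z : Feature f × ℝ => score g z.1 z.2 θ) ν := by
  have h1 := hM.measurable_g θ
  have h2 := hM.measurable_weight θ
  have h3 : AEStronglyMeasurable (fun z : Feature f × ℝ => weight g z.1 θ * (z.2 - g z.1 θ)) ν :=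
    (h2.mul (measurable_snd.sub h1)).aestronglyMeasurable
  exact h3.smul (hM.aestronglyMeasurable_grad hθ)

lemma aestronglyMeasurable_infoOp (hM : BinaryRegression ν g Θ θ₀) :
    AEStronglyMeasurable (fun z : Feature f × ℝ => infoOp g θ₀ z.1) ν :=
  (hM.regular.aestronglyMeasurable_infoOp hM.mem).comp_measurable measurable_fst

lemma integrable_infoOp (hM : BinaryRegression ν g Θ θ₀) :
    Integrable (fun z : Feature f × ℝ => infoOp g θ₀ z.1) ν := by
  obtain ⟨H, hH, hdom⟩ := hM.exists_dominating
  refine hH.mono' hM.aestronglyMeasurable_infoOp ?_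
  filter_upwards [hdom] with z hz
  obtain ⟨h1, -, h3, -⟩ := hz.2 θ₀ hM.mem
  exact norm_infoOp_le h1 h3

lemma integrable_residualOp (hM : BinaryRegression ν g Θ θ₀) :
    Integrable (residualOp g θ₀) (ν.map Prod.fst) := by
  obtain ⟨H, hH, hdom⟩ := hM.regular.dominated
  refine (hH.const_mul 2).mono' (hM.regular.aestronglyMeasurable_residualOp hM.mem_interior) ?_
  filter_upwards [hdom, hM.regular.mem_Ioo] with t h1 h2
  exact norm_residualOp_le (h2 θ₀ hM.mem) (h1 θ₀ hM.mem).1 (h1 θ₀ hM.mem).2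

/-- Residuals are orthogonal to vector valued functions of the features. -/
lemma integral_residual_smul {V : Type*} [NormedAddCommGroup V] [NormedSpace ℝ V]
    [CompleteSpace V] (hM : BinaryRegression ν g Θ θ₀) {h : Feature f → V}
    (hh : Integrable h (ν.map Prod.fst)) :
    Integrable (fun z => (z.2 - g z.1 θ₀) • h z.1) ν ∧
      ∫ z, (z.2 - g z.1 θ₀) • h z.1 ∂ν = 0 := by
  have h1 := hM.measurable_g θ₀
  have hint : Integrable (fun z : Feature f × ℝ => (z.2 - g z.1 θ₀) • h z.1) ν := by
    refine (hh.comp_measurable measurable_fst).bdd_smul 1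
      (measurable_snd.sub h1).aestronglyMeasurable ?_
    filter_upwards [hM.binary, ae_fst hM.regular.mem_Ioo] with z h2 h3
    exact abs_sub_le_one (h3 θ₀ hM.mem) h2
  refine ⟨hint, SeparatingDual.eq_zero_of_forall_dual_eq_zero (R := ℝ) fun L => ?_⟩
  rw [← L.integral_comp_comm hint, ← hM.residual _ (L.integrable_comp hh)]
  simp

lemma memLp_score (hM : BinaryRegression ν g Θ θ₀) :
    MemLp (fun z : Feature f × ℝ => score g z.1 z.2 θ₀) 2 ν := by
  obtain ⟨H, hH, hdom⟩ := hM.exists_dominating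
  rw [memLp_two_iff_integrable_sq_norm (hM.aestronglyMeasurable_score hM.mem)]
  refine hH.mono' ((hM.aestronglyMeasurable_score hM.mem).norm.pow 2) ?_
  filter_upwards [hdom] with z hz
  obtain ⟨h1, -, h3, -⟩ := hz.2 θ₀ hM.mem
  rw [Real.norm_of_nonneg (sq_nonneg _)]
  refine le_trans ?_ h3
  gcongr
  exact norm_score_le h1 hz.1

lemma integrable_weight_smul_grad (hM : BinaryRegression ν g Θ θ₀) :
    Integrable (fun t => weight g t θ₀ • grad g t θ₀) (ν.map Prod.fst) := by
  have := hM.prob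
  have : IsProbabilityMeasure (ν.map Prod.fst) :=
    Measure.isProbabilityMeasure_map measurable_fst.aemeasurable
  obtain ⟨H, hH, hdom⟩ := hM.regular.dominated
  -- Only the square of `w ‖g'‖` is dominated; `x ≤ x² + 1` accounts for the added constant.
  refine (hH.add (integrable_const (1 : ℝ))).mono'
    ((hM.regular.measurable_weight θ₀).aestronglyMeasurable.smul
      (hM.regular.aestronglyMeasurable_grad hM.mem)) ?_
  filter_upwards [hdom, hM.regular.mem_Ioo] with t h1 h2
  have h3 := (h1 θ₀ hM.mem).1
  rw [norm_smul, Real.norm_of_nonneg (weight_pos (h2 θ₀ hM.mem)).le, Pi.add_apply]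
  nlinarith [sq_nonneg (weight g t θ₀ * ‖grad g t θ₀‖ - 1)]

lemma integral_score (hM : BinaryRegression ν g Θ θ₀) : ∫ z, score g z.1 z.2 θ₀ ∂ν = 0 := by
  rw [← (hM.integral_residual_smul hM.integrable_weight_smul_grad).2]
  refine integral_congr_ae (.of_forall fun z => ?_)
  simp only [score, smul_smul, mul_comm]

lemma integral_scoreDeriv (hM : BinaryRegression ν g Θ θ₀) :
    Integrable (scoreDeriv g θ₀) ν ∧ ∫ z, scoreDeriv g θ₀ z ∂ν = -meanInfoOp ν g θ₀ := by
  obtain ⟨h1, h2⟩ := hM.integral_residual_smul hM.integrable_residualOp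
  refine ⟨h1.sub hM.integrable_infoOp, ?_⟩
  simp only [scoreDeriv]
  rw [integral_sub h1 hM.integrable_infoOp, h2, zero_sub, meanInfoOp]

lemma inner_meanInfoOp (hM : BinaryRegression ν g Θ θ₀) (u v : Param k) :
    ⟪meanInfoOp ν g θ₀ u, v⟫ =
      ∫ z, weight g z.1 θ₀ * ⟪grad g z.1 θ₀, u⟫ * ⟪grad g z.1 θ₀, v⟫ ∂ν := by
  have h1 := (ContinuousLinearMap.apply ℝ (Param k) u).integral_comp_comm hM.integrable_infoOp
  simp only [ContinuousLinearMap.apply_apply] at h1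
  have h2 := (innerSL ℝ v).integral_comp_comm
    (hM.integrable_infoOp.apply_continuousLinearMap u)
  rw [real_inner_comm, meanInfoOp, ← h1, ← innerSL_apply_apply ℝ, ← h2]
  refine integral_congr_ae (.of_forall fun z => ?_)
  simp only [infoOp, smul_apply, rankOne_apply, innerSL_apply_apply, inner_smul_right]
  rw [real_inner_comm (grad g z.1 θ₀) v]
  ring

lemma inner_meanInfoOp_comm (hM : BinaryRegression ν g Θ θ₀) (u v : Param k) :
    ⟪meanInfoOp ν g θ₀ u, v⟫ = ⟪u, meanInfoOp ν g θ₀ v⟫ := by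
  rw [real_inner_comm (meanInfoOp ν g θ₀ v) u, hM.inner_meanInfoOp, hM.inner_meanInfoOp]
  congr 1 with z
  ring

/-- The information operator has a continuous inverse if the information matrix is invertible. -/
lemma exists_inverse_meanInfoOp (hM : BinaryRegression ν g Θ θ₀)
    (hA : IsUnit (Matrix.of fun a b : Fin k => ∫ z, weight g z.1 θ₀ * grad g z.1 θ₀ a *
      grad g z.1 θ₀ b ∂ν)) :
    ∃ B : Param k →L[ℝ] Param k, (∀ u, B (meanInfoOp ν g θ₀ u) = u) ∧
      ∀ u, meanInfoOp ν g θ₀ (B u) = u := by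
  have hinj : Function.Injective (meanInfoOp ν g θ₀ : Param k →ₗ[ℝ] Param k) := by
    rw [injective_iff_map_eq_zero]
    intro u hu
    -- In the standard basis the operator has the given matrix, so a vector in its kernel is killed
    -- by an invertible matrix. Injectivity suffices in finite dimension.
    have hmul : (Matrix.of fun a b : Fin k => ∫ z, weight g z.1 θ₀ * grad g z.1 θ₀ a *
        grad g z.1 θ₀ b ∂ν).mulVec u.ofLp = 0 := by
      ext a
      have h1 : ⟪meanInfoOp ν g θ₀ (EuclideanSpace.basisFun (Fin k) ℝ a), u⟫ = 0 := by
        rw [hM.inner_meanInfoOp_comm]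
        simp only [ContinuousLinearMap.coe_coe] at hu
        rw [hu, inner_zero_right]
      have h2 (u' : Param k) : u' = ∑ b, u' b • EuclideanSpace.basisFun (Fin k) ℝ b := by
        simpa using ((EuclideanSpace.basisFun (Fin k) ℝ).sum_repr u').symm
      have h3 (b : Fin k) : ⟪meanInfoOp ν g θ₀ (EuclideanSpace.basisFun (Fin k) ℝ a),
          EuclideanSpace.basisFun (Fin k) ℝ b⟫ =
          ∫ z, weight g z.1 θ₀ * grad g z.1 θ₀ a * grad g z.1 θ₀ b ∂ν := by
        rw [hM.inner_meanInfoOp]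
        simp [EuclideanSpace.inner_single_right]
      rw [h2 u, inner_sum] at h1
      simp only [inner_smul_right, h3] at h1
      simp only [Matrix.mulVec, dotProduct, Matrix.of_apply, Pi.zero_apply]
      rw [← h1]
      exact Finset.sum_congr rfl fun b _ => mul_comm _ _
    have h0 := Matrix.mulVec_injective_iff_isUnit.2 hA (hmul.trans (Matrix.mulVec_zero _).symm)
    ext a
    exact congrFun h0 a
  let e := (LinearEquiv.ofInjectiveEndo _ hinj).toContinuousLinearEquiv
  exact ⟨e.symm, fun u => e.symm_apply_apply u, fun u => e.apply_symm_apply u⟩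

lemma memLp_of_abs_le (hM : BinaryRegression ν g Θ θ₀) {φ : Feature f × ℝ → ℝ}
    (hφ : Measurable φ) {C : ℝ} (h : ∀ᵐ z ∂ν, |φ z| ≤ C) : MemLp φ 2 ν :=
  have := hM.prob
  MemLp.of_bound hφ.aestronglyMeasurable C h

lemma memLp_ind (hM : BinaryRegression ν g Θ θ₀) (hW : MeasurableSet W) :
    MemLp (fun z : Feature f × ℝ => ind W z.1) 2 ν :=
  hM.memLp_of_abs_le ((measurable_ind hW).comp measurable_fst)
    (.of_forall fun z => abs_ind_le_one W z.1)

lemma memLp_ind_mul_g (hM : BinaryRegression ν g Θ θ₀) (hW : MeasurableSet W) :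
    MemLp (fun z : Feature f × ℝ => ind W z.1 * g z.1 θ₀) 2 ν := by
  refine hM.memLp_of_abs_le (C := 1)
    (((measurable_ind hW).comp measurable_fst).mul (hM.measurable_g θ₀)) ?_
  filter_upwards [ae_fst hM.regular.mem_Ioo] with z hz
  rw [abs_mul, abs_of_pos (hz θ₀ hM.mem).1]
  exact mul_le_one₀ (abs_ind_le_one W z.1) (hz θ₀ hM.mem).1.le (hz θ₀ hM.mem).2.le

lemma memLp_ind_mul_residual (hM : BinaryRegression ν g Θ θ₀) (hW : MeasurableSet W) :
    MemLp (fun z : Feature f × ℝ => ind W z.1 * (z.2 - g z.1 θ₀)) 2 ν := by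
  refine hM.memLp_of_abs_le (C := 1)
    (((measurable_ind hW).comp measurable_fst).mul (measurable_snd.sub (hM.measurable_g θ₀))) ?_
  filter_upwards [hM.binary, ae_fst hM.regular.mem_Ioo] with z hy hz
  rw [abs_mul]
  exact mul_le_one₀ (abs_ind_le_one W z.1) (abs_nonneg _) (abs_sub_le_one (hz θ₀ hM.mem) hy)

/-- The conditional variance of the residual is `g (1 - g)`. -/
lemma integral_residual_sq (hM : BinaryRegression ν g Θ θ₀) {h : Feature f → ℝ}
    (hh : Integrable h (ν.map Prod.fst)) :
    ∫ z, (z.2 - g z.1 θ₀) ^ 2 * h z.1 ∂ν = ∫ z, g z.1 θ₀ * (1 - g z.1 θ₀) * h z.1 ∂ν := by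
  have hg := hM.regular.measurable_apply θ₀
  have hIoo := hM.regular.mem_Ioo
  have h1 : Integrable (fun t => (1 - 2 * g t θ₀) * h t) (ν.map Prod.fst) := by
    refine hh.bdd_mul (c := 1) (Measurable.aestronglyMeasurable (by fun_prop)) ?_
    filter_upwards [hIoo] with t ht
    exact abs_le.2 ⟨by linarith [(ht θ₀ hM.mem).2], by linarith [(ht θ₀ hM.mem).1]⟩
  have h2 : Integrable (fun t => g t θ₀ * (1 - g t θ₀) * h t) (ν.map Prod.fst) := by
    refine hh.bdd_mul (c := 1) (Measurable.aestronglyMeasurable (by fun_prop)) ?_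
    filter_upwards [hIoo] with t ht
    obtain ⟨h3, h4⟩ := ht θ₀ hM.mem
    rw [Real.norm_of_nonneg (by nlinarith)]
    nlinarith
  obtain ⟨h3, h4⟩ := hM.integral_residual_smul h1
  simp only [smul_eq_mul] at h3 h4
  -- For `y ∈ {0, 1}`, `(y - g)² = g (1 - g) + (y - g)(1 - 2g)`, and the last term is a residual
  -- times a function of the features.
  have h5 : (fun z : Feature f × ℝ => (z.2 - g z.1 θ₀) ^ 2 * h z.1) =ᵐ[ν] fun z =>
      g z.1 θ₀ * (1 - g z.1 θ₀) * h z.1 + (z.2 - g z.1 θ₀) * ((1 - 2 * g z.1 θ₀) * h z.1) := by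
    filter_upwards [hM.binary] with z hz
    rcases hz with hz | hz <;> rw [hz] <;> ring
  have h6 : Integrable (fun z : Feature f × ℝ => g z.1 θ₀ * (1 - g z.1 θ₀) * h z.1) ν :=
    h2.comp_measurable measurable_fst
  rw [integral_congr_ae h5, integral_add h6 h3, h4, add_zero]

lemma memLp_weight_mul_inner_grad (hM : BinaryRegression ν g Θ θ₀) (c : Param k) :
    MemLp (fun t => weight g t θ₀ * ⟪grad g t θ₀, c⟫) 2 (ν.map Prod.fst) := by
  obtain ⟨H, hH, hdom⟩ := hM.regular.dominated
  have hmeas : AEStronglyMeasurable (fun t => weight g t θ₀ * ⟪grad g t θ₀, c⟫)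
      (ν.map Prod.fst) := (hM.regular.measurable_weight θ₀).aestronglyMeasurable.mul
    ((hM.regular.aestronglyMeasurable_grad hM.mem).inner aestronglyMeasurable_const)
  rw [memLp_two_iff_integrable_sq hmeas]
  refine (hH.mul_const (‖c‖ ^ 2)).mono' (hmeas.pow 2) ?_
  filter_upwards [hdom, hM.regular.mem_Ioo] with t h1 h2
  have h3 := weight_pos (h2 θ₀ hM.mem)
  rw [norm_pow, norm_mul, Real.norm_of_nonneg h3.le]
  calc (weight g t θ₀ * ‖⟪grad g t θ₀, c⟫‖) ^ 2
      ≤ (weight g t θ₀ * (‖grad g t θ₀‖ * ‖c‖)) ^ 2 := by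
        gcongr
        exact norm_inner_le_norm _ _
    _ = (weight g t θ₀ * ‖grad g t θ₀‖) ^ 2 * ‖c‖ ^ 2 := by ring
    _ ≤ H t * ‖c‖ ^ 2 := by
        gcongr
        exact (h1 θ₀ hM.mem).1

lemma inner_score (c : Param k) (z : Feature f × ℝ) : ⟪score g z.1 z.2 θ₀, c⟫ =
    (z.2 - g z.1 θ₀) * (weight g z.1 θ₀ * ⟪grad g z.1 θ₀, c⟫) := by
  rw [score, real_inner_smul_left]
  ring

/-- The information identity: the squared residual has conditional mean `g (1 - g) = 1 / w`, which
cancels one of the two weights in the squared score. -/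
lemma integral_inner_score_sq (hM : BinaryRegression ν g Θ θ₀) (c : Param k) :
    ∫ z, ⟪score g z.1 z.2 θ₀, c⟫ ^ 2 ∂ν = ⟪meanInfoOp ν g θ₀ c, c⟫ := by
  rw [hM.inner_meanInfoOp]
  have h1 := hM.integral_residual_sq (hM.memLp_weight_mul_inner_grad c).integrable_sq
  simp only [inner_score, mul_pow] at h1 ⊢
  rw [h1]
  refine integral_congr_ae ?_
  filter_upwards [ae_fst hM.regular.mem_Ioo] with z hz
  linear_combination (weight g z.1 θ₀ * ⟪grad g z.1 θ₀, c⟫ ^ 2) * weight_mul (hz θ₀ hM.mem)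

lemma integrable_ind_smul_grad (hM : BinaryRegression ν g Θ θ₀) (hW : MeasurableSet W) :
    Integrable (fun z : Feature f × ℝ => ind W z.1 • grad g z.1 θ₀) ν := by
  refine (hM.integrable_weight_smul_grad.comp_measurable measurable_fst).mono
    (((measurable_ind hW).comp measurable_fst).aestronglyMeasurable.smul
      (hM.aestronglyMeasurable_grad hM.mem)) ?_
  filter_upwards [ae_fst hM.regular.mem_Ioo] with z hz
  rw [norm_smul, Function.comp_apply, norm_smul,
    Real.norm_of_nonneg (weight_pos (hz θ₀ hM.mem)).le]
  exact (mul_le_of_le_one_left (norm_nonneg _) (abs_ind_le_one W z.1)).trans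
    (norm_grad_le (hz θ₀ hM.mem))

/-- Here the squared residual meets a single weight and cancels it completely. Together with the
information identity this gives `E RS = E S²`. -/
lemma integral_ind_mul_residual_mul_inner_score (hM : BinaryRegression ν g Θ θ₀)
    (hW : MeasurableSet W) (c : Param k) :
    ∫ z, ind W z.1 * (z.2 - g z.1 θ₀) * ⟪score g z.1 z.2 θ₀, c⟫ ∂ν =
      ⟪subclassGrad ν g θ₀ W, c⟫ := by
  have := hM.prob
  have : IsProbabilityMeasure (ν.map Prod.fst) :=
    Measure.isProbabilityMeasure_map measurable_fst.aemeasurable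
  have h0 : Integrable (fun t => ind W t * (weight g t θ₀ * ⟪grad g t θ₀, c⟫))
      (ν.map Prod.fst) :=
    ((hM.memLp_weight_mul_inner_grad c).integrable one_le_two).bdd_mul (c := 1)
      (measurable_ind hW).aestronglyMeasurable (.of_forall fun t => abs_ind_le_one W t)
  have h1 := hM.integral_residual_sq h0
  have h2 := (innerSL ℝ c).integral_comp_comm (hM.integrable_ind_smul_grad hW)
  simp only [innerSL_apply_apply] at h2
  rw [subclassGrad, real_inner_comm, ← h2]
  trans ∫ z, (z.2 - g z.1 θ₀) ^ 2 * (ind W z.1 * (weight g z.1 θ₀ * ⟪grad g z.1 θ₀, c⟫)) ∂ν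
  · refine integral_congr_ae (.of_forall fun z => ?_)
    simp only [inner_score]
    ring
  rw [h1]
  refine integral_congr_ae ?_
  filter_upwards [ae_fst hM.regular.mem_Ioo] with z hz
  rw [real_inner_smul_right, real_inner_comm (grad g z.1 θ₀) c]
  linear_combination (ind W z.1 * ⟪grad g z.1 θ₀, c⟫) * weight_mul (hz θ₀ hM.mem)

lemma integral_inner_score_mul (hM : BinaryRegression ν g Θ θ₀) (c : Param k)
    {φ : Feature f → ℝ} (hφ : MemLp φ 2 (ν.map Prod.fst)) :
    ∫ z, ⟪score g z.1 z.2 θ₀, c⟫ * φ z.1 ∂ν = 0 := by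
  rw [← hM.residual _ ((hM.memLp_weight_mul_inner_grad c).integrable_mul hφ)]
  refine integral_congr_ae (.of_forall fun z => ?_)
  simp only [inner_score, Pi.mul_apply]
  ring

lemma integral_ind_mul_residual_mul (hM : BinaryRegression ν g Θ θ₀) (hW : MeasurableSet W)
    {φ : Feature f → ℝ} (hφ : Integrable φ (ν.map Prod.fst)) :
    ∫ z, ind W z.1 * (z.2 - g z.1 θ₀) * φ z.1 ∂ν = 0 := by
  rw [← hM.residual (fun t => ind W t * φ t) (hφ.bdd_mul (c := 1)
    (measurable_ind hW).aestronglyMeasurable (.of_forall fun t => abs_ind_le_one W t))]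
  refine integral_congr_ae (.of_forall fun z => ?_)
  ring

end BinaryRegression

end SubclassEstimation

/-! ### Slutsky arguments and changes of scale. -/

section Slutsky

variable {Ω : Type*} [MeasurableSpace Ω] {P : Measure Ω}

/-- Splits the difference as `(A - B) / D + (D⁻¹ - p⁻¹) B`. -/
lemma tendsto_div_sub_inv_mul {A B D : ℕ → Ω → ℝ} {p : ℝ} (hp : p ≠ 0)
    (hAB : Tendsto (fun x => A x.1 x.2 - B x.1 x.2) (inProb P) (𝓝 0)) (hB : BoundedInProb P B)
    (hD : Tendsto (fun x => D x.1 x.2) (inProb P) (𝓝 p)) :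
    Tendsto (fun x => A x.1 x.2 / D x.1 x.2 - p⁻¹ * B x.1 x.2) (inProb P) (𝓝 0) := by
  have hinv := hD.inv₀ hp
  have h1 := hAB.mul hinv
  have h2 : Tendsto (fun x => ((D x.1 x.2)⁻¹ - p⁻¹) * B x.1 x.2) (inProb P) (𝓝 0) := by
    have h3 := (hB.tendsto_mul (by simpa using hinv.sub_const p⁻¹)).norm
    rw [norm_zero] at h3
    rw [tendsto_zero_iff_norm_tendsto_zero]
    exact h3.congr fun x => by rw [norm_mul, norm_norm, norm_mul]
  have h4 := h1.add h2
  rw [zero_mul, zero_add] at h4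
  exact h4.congr fun x => by rw [div_eq_mul_inv]; ring

/-- Passage from the scaling `√(r n)` to the scaling `√n`. -/
lemma BoundedInProb.sqrt_smul_comp {G : Type*} [NormedAddCommGroup G] [NormedSpace ℝ G]
    {F : ℕ → Ω → G} (hF : BoundedInProb P fun m ω => √(m : ℝ) • F m ω) {r : ℕ → ℕ} {γ : ℝ}
    (hγ : 0 < γ) (hrγ : Tendsto (fun n : ℕ => (r n : ℝ) / n) atTop (𝓝 γ))
    (hr_top : Tendsto r atTop atTop) : BoundedInProb P fun n ω => √(n : ℝ) • F (r n) ω := by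
  refine (hF.comp_tendsto hr_top).mono (K := √(2 / γ)) (Real.sqrt_nonneg _) ?_
  -- Half of the limiting fraction is a safe lower bound for `r n / n`, whence the factor `√(2 /
  -- γ)`.
  have h1 : ∀ᶠ n : ℕ in atTop, γ / 2 < (r n : ℝ) / n :=
    hrγ.eventually_const_lt (by linarith)
  refine (eventually_inProb_of_eventually (P := P) (h1.and (eventually_gt_atTop 0))).mono ?_
  rintro ⟨n, ω⟩ ⟨h2, h3⟩
  have h3' : (0 : ℝ) < n := by exact_mod_cast h3
  rw [lt_div_iff₀ h3'] at h2
  have h4 : √(n : ℝ) ≤ √(2 / γ) * √(r n : ℝ) := by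
    rw [← Real.sqrt_mul (by positivity)]
    refine Real.sqrt_le_sqrt ?_
    rw [div_mul_eq_mul_div, le_div_iff₀ hγ]
    linarith
  simp only [norm_smul, Real.norm_of_nonneg (Real.sqrt_nonneg _)]
  rw [← mul_assoc]
  gcongr

/-- If `D n` is negligible compared with `h n`, and `√n h n` is bounded in probability, then
`√n D n → 0` in probability. -/
lemma tendsto_sqrt_mul_of_negligible {E : Type*} [NormedAddCommGroup E] [NormedSpace ℝ E]
    {D : ℕ → Ω → ℝ} {h : ℕ → Ω → E} (hh : BoundedInProb P fun n ω => √(n : ℝ) • h n ω)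
    (hD : ∀ ε > 0, ∀ᶠ x in inProb P, |D x.1 x.2| ≤ ε * ‖h x.1 x.2‖) :
    Tendsto (fun x => √(x.1 : ℝ) * D x.1 x.2) (inProb P) (𝓝 0) := by
  have ha : Tendsto (fun x => |D x.1 x.2| / ‖h x.1 x.2‖) (inProb P) (𝓝 0) := by
    rw [Metric.tendsto_nhds]
    intro ε hε
    filter_upwards [hD (ε / 2) (half_pos hε)] with x hx
    rw [dist_zero_right, Real.norm_of_nonneg (by positivity)]
    exact (div_le_of_le_mul₀ (norm_nonneg _) (half_pos hε).le hx).trans_lt (half_lt_self hε)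
  rw [tendsto_zero_iff_norm_tendsto_zero]
  refine (hh.tendsto_mul ha).congr' ?_
  filter_upwards [hD 1 one_pos] with x hx
  rw [norm_smul, norm_mul, Real.norm_eq_abs (D _ _)]
  -- Where `h` vanishes the quotient is `0` by convention, and the hypothesis with `ε = 1` forces `D
  -- = 0` too.
  rcases eq_or_ne (‖h x.1 x.2‖) 0 with h0 | h0
  · rw [h0, mul_zero] at hx
    rw [h0, le_antisymm hx (abs_nonneg _)]
    simp
  · field_simp

end Slutsky

section Expansion

variable {Ω T E G : Type*} [MeasurableSpace Ω] [MeasurableSpace T] {P : Measure Ω}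
  [IsProbabilityMeasure P] {ν : Measure T} {Z : ℕ → Ω → T} [NormedAddCommGroup G] [NormedSpace ℝ G]

/-- First order expansion of a sample mean at a consistent estimator, with the sample mean of the
derivative replaced by its expectation. -/
lemma IsIIDSample.eventually_norm_sampleMean_sub_integral_le [CompleteSpace G]
    [NormedAddCommGroup E] [NormedSpace ℝ E] [SecondCountableTopology E] (hZ : IsIIDSample P ν Z)
    {F : T → E → G} {D : T → E →L[ℝ] G} {θ₀ : E} {δ₀ : ℝ} {L : T → ℝ} (hδ₀ : 0 < δ₀)
    (hmeas : ∀ θ ∈ Metric.ball θ₀ δ₀, AEStronglyMeasurable (fun t => F t θ) ν)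
    (hDint : Integrable D ν) (hD : ∀ᵐ t ∂ν, HasFDerivAt (F t) (D t) θ₀)
    (hF : ∀ᵐ t ∂ν, ∀ θ ∈ Metric.ball θ₀ δ₀, DifferentiableAt ℝ (F t) θ ∧ ‖fderiv ℝ (F t) θ‖ ≤ L t)
    (hL : Integrable L ν) {θhat : ℕ → Ω → E}
    (hθ : Tendsto (fun x => θhat x.1 x.2) (inProb P) (𝓝 θ₀)) {m : ℕ → ℕ}
    (hm : Tendsto m atTop atTop) {ε : ℝ} (hε : 0 < ε) :
    ∀ᶠ x in inProb P, ‖sampleMean Z (fun t => F t (θhat x.1 x.2)) (m x.1) x.2 -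
      sampleMean Z (fun t => F t θ₀) (m x.1) x.2 -
      (∫ t, D t ∂ν) (θhat x.1 x.2 - θ₀)‖ ≤ ε * ‖θhat x.1 x.2 - θ₀‖ := by
  have h1 := hZ.eventually_norm_sampleMean_sub_le hδ₀ hmeas hDint.aestronglyMeasurable hD hF hL hθ m
    (half_pos hε)
  have h2 := Metric.tendsto_nhds.1 (hZ.tendsto_sampleMean hDint hm) _ (half_pos hε)
  filter_upwards [h1, h2] with x h1 h2
  rw [dist_eq_norm] at h2
  set u := θhat x.1 x.2 - θ₀
  set S := sampleMean Z D (m x.1) x.2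
  have h3 : ‖(S - ∫ t, D t ∂ν) u‖ ≤ ε / 2 * ‖u‖ :=
    (ContinuousLinearMap.le_opNorm _ _).trans (by gcongr)
  calc _ = ‖(sampleMean Z (fun t => F t (θhat x.1 x.2)) (m x.1) x.2 -
      sampleMean Z (fun t => F t θ₀) (m x.1) x.2 - S u) + (S - ∫ t, D t ∂ν) u‖ := by
        rw [sub_apply]
        congr 1
        abel
    _ ≤ ε / 2 * ‖u‖ + ε / 2 * ‖u‖ := (norm_add_le _ _).trans (add_le_add h1 h3)
    _ = ε * ‖u‖ := by ring

end Expansion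

/-! ### Consistency, rate and linearization of the estimators. -/

namespace SubclassEstimation.BinaryRegression

variable {f k : ℕ} {ν : Measure (Feature f × ℝ)} {g : Feature f → Param k → ℝ} {Θ : Set (Param k)}
  {θ₀ : Param k} {W : Set (Feature f)} {Ω : Type*} [MeasurableSpace Ω] {P : Measure Ω}
  [IsProbabilityMeasure P] {Z : ℕ → Ω → Feature f × ℝ}

lemma tendsto_of_root (hM : BinaryRegression ν g Θ θ₀) (hZ : IsIIDSample P ν Z)
    (hΘ : IsCompact Θ) (hid : ∀ θ ∈ Θ, ∫ z, score g z.1 z.2 θ ∂ν = 0 → θ = θ₀) {r : ℕ → ℕ}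
    (hr_top : Tendsto r atTop atTop) {θhat : ℕ → Ω → Param k}
    (hroot : ∀ᶠ x in inProb P, θhat x.1 x.2 ∈ Θ ∧
      sampleMean Z (fun z => score g z.1 z.2 (θhat x.1 x.2)) (r x.1) x.2 = 0) :
    Tendsto (fun x => θhat x.1 x.2) (inProb P) (𝓝 θ₀) := by
  have := hM.prob
  obtain ⟨H, hH, hdom⟩ := hM.exists_dominating
  refine hZ.tendsto_root (s := fun z θ => score g z.1 z.2 θ) hΘ
    (fun θ hθ => hM.aestronglyMeasurable_score hθ) ?_ (hH.add (integrable_const (1 : ℝ))) ?_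
    hid hr_top hroot
  · filter_upwards [hdom] with z hz θ hθ
    obtain ⟨h1, h2, -, -⟩ := hz.2 θ hθ
    exact (continuousAt_score h1 h2 z.2).continuousWithinAt
  · filter_upwards [hdom] with z hz θ hθ
    obtain ⟨h1, -, h3, -⟩ := hz.2 θ hθ
    refine (norm_score_le h1 hz.1).trans ?_
    rw [Pi.add_apply]
    nlinarith [sq_nonneg (weight g z.1 θ * ‖grad g z.1 θ‖ - 1)]

lemma exists_ball_subset (hM : BinaryRegression ν g Θ θ₀) : ∃ δ > 0, Metric.ball θ₀ δ ⊆ Θ :=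
  Metric.mem_nhds_iff.1 (mem_interior_iff_mem_nhds.1 hM.mem_interior)

/-- Linearization of the estimating equation. -/
lemma eventually_norm_sampleMean_score_sub_le (hM : BinaryRegression ν g Θ θ₀)
    (hZ : IsIIDSample P ν Z) {r : ℕ → ℕ} (hr_top : Tendsto r atTop atTop)
    {θhat : ℕ → Ω → Param k} (hroot : ∀ᶠ x in inProb P, θhat x.1 x.2 ∈ Θ ∧
      sampleMean Z (fun z => score g z.1 z.2 (θhat x.1 x.2)) (r x.1) x.2 = 0)
    (hθ : Tendsto (fun x => θhat x.1 x.2) (inProb P) (𝓝 θ₀)) {ε : ℝ} (hε : 0 < ε) :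
    ∀ᶠ x in inProb P, ‖sampleMean Z (fun z => score g z.1 z.2 θ₀) (r x.1) x.2 -
      meanInfoOp ν g θ₀ (θhat x.1 x.2 - θ₀)‖ ≤ ε * ‖θhat x.1 x.2 - θ₀‖ := by
  obtain ⟨δ, hδ, hball⟩ := hM.exists_ball_subset
  obtain ⟨H, hH, hdom⟩ := hM.exists_dominating
  have h := hZ.eventually_norm_sampleMean_sub_integral_le (F := fun z θ => score g z.1 z.2 θ)
    (D := scoreDeriv g θ₀) (L := fun z => 3 * H z) hδ
    (fun θ hθ => hM.aestronglyMeasurable_score (hball hθ)) hM.integral_scoreDeriv.1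
    (by
      filter_upwards [hdom] with z hz
      obtain ⟨h1, h2, -, -⟩ := hz.2 θ₀ hM.mem
      exact hasFDerivAt_score h1 h2 z.2)
    (by
      filter_upwards [hdom] with z hz θ hθ
      obtain ⟨h1, h2, h3, h4⟩ := hz.2 θ (hball hθ)
      have h5 := hasFDerivAt_score h1 h2 z.2
      exact ⟨h5.differentiableAt, h5.fderiv ▸ norm_scoreDeriv_le h1 hz.1 h3 h4⟩)
    (hH.const_mul 3) hθ hr_top hε
  filter_upwards [h, hroot] with x h1 h2
  rw [hM.integral_scoreDeriv.2, h2.2, zero_sub, neg_apply, sub_neg_eq_add, ← norm_neg, neg_add,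
    neg_neg, ← sub_eq_add_neg] at h1
  exact h1

/-- Linearization of the subclass mean of the regression function. -/
lemma eventually_abs_sampleMean_ind_mul_sub_le (hM : BinaryRegression ν g Θ θ₀)
    (hZ : IsIIDSample P ν Z) (hW : MeasurableSet W) {θhat : ℕ → Ω → Param k}
    (hθ : Tendsto (fun x => θhat x.1 x.2) (inProb P) (𝓝 θ₀)) {ε : ℝ} (hε : 0 < ε) :
    ∀ᶠ x in inProb P, |sampleMean Z (fun z => ind W z.1 * g z.1 (θhat x.1 x.2)) x.1 x.2 -
      sampleMean Z (fun z => ind W z.1 * g z.1 θ₀) x.1 x.2 -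
      ⟪subclassGrad ν g θ₀ W, θhat x.1 x.2 - θ₀⟫| ≤ ε * ‖θhat x.1 x.2 - θ₀‖ := by
  have := hM.prob
  obtain ⟨δ, hδ, hball⟩ := hM.exists_ball_subset
  obtain ⟨H, hH, hdom⟩ := hM.exists_dominating
  have hgrad := hM.integrable_ind_smul_grad hW
  have hderiv {z : Feature f × ℝ} {θ : Param k} (hg : ContDiffAt ℝ 2 (g z.1) θ) :
      HasFDerivAt (fun θ => ind W z.1 * g z.1 θ) (innerSL ℝ (ind W z.1 • grad g z.1 θ)) θ := by
    rw [map_smul]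
    exact (hasFDerivAt_innerSL_grad hg).const_mul _
  have h := hZ.eventually_norm_sampleMean_sub_integral_le
    (F := fun z θ => ind W z.1 * g z.1 θ)
    (D := fun z => innerSL ℝ (ind W z.1 • grad g z.1 θ₀)) (L := fun z => H z + 1) hδ
    (fun θ _ => (((measurable_ind hW).comp measurable_fst).mul
      (hM.measurable_g θ)).aestronglyMeasurable)
    ((innerSL ℝ (E := Param k)).integrable_comp hgrad)
    (by
      filter_upwards [hdom] with z hz
      exact hderiv (hz.2 θ₀ hM.mem).2.1)
    (by
      filter_upwards [hdom] with z hz θ hθ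
      obtain ⟨h1, h2, h3, -⟩ := hz.2 θ (hball hθ)
      refine ⟨(hderiv h2).differentiableAt, ?_⟩
      rw [(hderiv h2).fderiv, innerSL_apply_norm, norm_smul]
      refine (mul_le_of_le_one_left (norm_nonneg _) (abs_ind_le_one W z.1)).trans
        ((norm_grad_le h1).trans ?_)
      nlinarith [sq_nonneg (weight g z.1 θ * ‖grad g z.1 θ‖ - 1)])
    (hH.add (integrable_const 1)) hθ tendsto_id hε
  filter_upwards [h] with x hx
  rw [(innerSL ℝ (E := Param k)).integral_comp_comm hgrad, innerSL_apply_apply] at hx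
  exact hx

/-- Roots of the estimating equation converge at rate `√n`. -/
lemma boundedInProb_sqrt_smul_sub (hM : BinaryRegression ν g Θ θ₀)
    (hZ : IsIIDSample P ν Z) {B : Param k →L[ℝ] Param k}
    (hB : ∀ u, B (meanInfoOp ν g θ₀ u) = u) {r : ℕ → ℕ} {γ : ℝ}
    (hγ : 0 < γ) (hrγ : Tendsto (fun n : ℕ => (r n : ℝ) / n) atTop (𝓝 γ))
    (hr_top : Tendsto r atTop atTop) {θhat : ℕ → Ω → Param k}
    (hlin : ∀ ε > 0, ∀ᶠ x in inProb P, ‖sampleMean Z (fun z => score g z.1 z.2 θ₀) (r x.1) x.2 -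
      meanInfoOp ν g θ₀ (θhat x.1 x.2 - θ₀)‖ ≤ ε * ‖θhat x.1 x.2 - θ₀‖) :
    BoundedInProb P fun n ω => √(n : ℝ) • (θhat n ω - θ₀) := by
  have := hM.prob
  have hψ := (hZ.boundedInProb_sqrt_smul_sampleMean hM.memLp_score hM.integral_score
    (hM.memLp_score.integrable one_le_two)).sqrt_smul_comp hγ hrγ hr_top
  refine hψ.mono (K := 2 * ‖B‖) (by positivity) ?_
  -- Chosen so that `‖B‖` times it is at most `1 / 2`: the remainder is then absorbed into the left
  -- side. The `+ 1` covers `B = 0`.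
  have hK : (0 : ℝ) < (2 * (‖B‖ + 1))⁻¹ := by positivity
  filter_upwards [hlin _ hK] with x hx
  set u := θhat x.1 x.2 - θ₀
  set ψ := sampleMean Z (fun z => score g z.1 z.2 θ₀) (r x.1) x.2
  have h1 : ‖u‖ ≤ ‖B‖ * ‖ψ‖ + ‖u‖ / 2 := by
    calc ‖u‖ = ‖B ψ - B (ψ - meanInfoOp ν g θ₀ u)‖ := by
          rw [map_sub, hB, sub_sub_cancel]
      _ ≤ ‖B‖ * ‖ψ‖ + ‖B‖ * ((2 * (‖B‖ + 1))⁻¹ * ‖u‖) := by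
          refine (norm_sub_le _ _).trans (add_le_add (B.le_opNorm _) ?_)
          exact (B.le_opNorm _).trans (by gcongr)
      _ ≤ ‖B‖ * ‖ψ‖ + ‖u‖ / 2 := by
          gcongr
          rw [mul_inv, ← mul_assoc, mul_left_comm, mul_assoc, inv_mul_eq_div]
          have h2 : ‖B‖ * (‖B‖ + 1)⁻¹ ≤ 1 := by
            rw [← div_eq_mul_inv]
            exact div_le_one_of_le₀ (by linarith) (by positivity)
          gcongr
          exact mul_le_of_le_one_left (norm_nonneg _) h2
  rw [norm_smul, norm_smul]
  have h3 : ‖u‖ ≤ 2 * ‖B‖ * ‖ψ‖ := by linarith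
  calc ‖√(x.1 : ℝ)‖ * ‖u‖ ≤ ‖√(x.1 : ℝ)‖ * (2 * ‖B‖ * ‖ψ‖) := by gcongr
    _ = 2 * ‖B‖ * (‖√(x.1 : ℝ)‖ * ‖ψ‖) := by ring

/-- Asymptotic linearity of the numerator of the estimator of the subclass probability. -/
lemma tendsto_sqrt_mul_sampleMean_sub (hM : BinaryRegression ν g Θ θ₀)
    (hZ : IsIIDSample P ν Z) (hW : MeasurableSet W) {r : ℕ → ℕ} {θhat : ℕ → Ω → Param k}
    (hlin : ∀ ε > 0, ∀ᶠ x in inProb P, ‖sampleMean Z (fun z => score g z.1 z.2 θ₀) (r x.1) x.2 -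
      meanInfoOp ν g θ₀ (θhat x.1 x.2 - θ₀)‖ ≤ ε * ‖θhat x.1 x.2 - θ₀‖)
    (hθ : Tendsto (fun x => θhat x.1 x.2) (inProb P) (𝓝 θ₀))
    (hrate : BoundedInProb P fun n ω => √(n : ℝ) • (θhat n ω - θ₀)) {c : Param k}
    (hc : meanInfoOp ν g θ₀ c = subclassGrad ν g θ₀ W) :
    Tendsto (fun x => √(x.1 : ℝ) *
      (sampleMean Z (fun z => ind W z.1 * g z.1 (θhat x.1 x.2)) x.1 x.2 -
        sampleMean Z (fun z => ind W z.1 * g z.1 θ₀) x.1 x.2 -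
        sampleMean Z (fun z => ⟪score g z.1 z.2 θ₀, c⟫) (r x.1) x.2)) (inProb P) (𝓝 0) := by
  refine tendsto_sqrt_mul_of_negligible (D := fun n ω =>
      sampleMean Z (fun z => ind W z.1 * g z.1 (θhat n ω)) n ω -
        sampleMean Z (fun z => ind W z.1 * g z.1 θ₀) n ω -
        sampleMean Z (fun z => ⟪score g z.1 z.2 θ₀, c⟫) (r n) ω) hrate fun ε hε => ?_
  have hK : 0 < ε / (2 * (‖c‖ + 1)) := by positivity
  filter_upwards [hlin _ hK, hM.eventually_abs_sampleMean_ind_mul_sub_le hZ hW hθ (half_pos hε)]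
    with x h1 h2
  have hinner : sampleMean Z (fun z => ⟪score g z.1 z.2 θ₀, c⟫) (r x.1) x.2 =
      ⟪c, sampleMean Z (fun z => score g z.1 z.2 θ₀) (r x.1) x.2⟫ := by
    rw [← innerSL_apply_apply ℝ, ContinuousLinearMap.map_sampleMean]
    simp only [innerSL_apply_apply, real_inner_comm]
  rw [hinner]
  set u := θhat x.1 x.2 - θ₀
  set ψ := sampleMean Z (fun z => score g z.1 z.2 θ₀) (r x.1) x.2
  have h3 : |⟪c, ψ - meanInfoOp ν g θ₀ u⟫| ≤ ε / 2 * ‖u‖ := by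
    refine (abs_real_inner_le_norm _ _).trans ?_
    calc ‖c‖ * ‖ψ - meanInfoOp ν g θ₀ u‖ ≤ ‖c‖ * (ε / (2 * (‖c‖ + 1)) * ‖u‖) := by gcongr
      _ = (‖c‖ / (‖c‖ + 1)) * (ε / 2 * ‖u‖) := by field_simp
      _ ≤ ε / 2 * ‖u‖ := mul_le_of_le_one_left (by positivity)
          (div_le_one_of_le₀ (by linarith) (by positivity))
  -- By symmetry of the information operator, `⟪c, I u⟫ = ⟪I c, u⟫ = ⟪E[I_W g'], u⟫`: the choice of
  -- `c` turns the effect of estimating the parameter into a mean of scores.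
  rw [inner_sub_right, ← hM.inner_meanInfoOp_comm, hc] at h3
  calc _ = |(sampleMean Z (fun z => ind W z.1 * g z.1 (θhat x.1 x.2)) x.1 x.2 -
        sampleMean Z (fun z => ind W z.1 * g z.1 θ₀) x.1 x.2 - ⟪subclassGrad ν g θ₀ W, u⟫) -
        (⟪c, ψ⟫ - ⟪subclassGrad ν g θ₀ W, u⟫)| := by congr 1; ring
    _ ≤ ε / 2 * ‖u‖ + ε / 2 * ‖u‖ := (abs_sub _ _).trans (add_le_add h2 h3)
    _ = ε * ‖u‖ := by ring

end SubclassEstimation.BinaryRegression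

lemma tendsto_atTop_of_ratio {r : ℕ → ℕ} {γ : ℝ} (hγ : 0 < γ)
    (hrγ : Tendsto (fun n : ℕ => (r n : ℝ) / n) atTop (𝓝 γ)) : Tendsto r atTop atTop := by
  refine tendsto_natCast_atTop_iff.1
    ((hrγ.pos_mul_atTop hγ (tendsto_natCast_atTop_atTop (R := ℝ))).congr' ?_)
  filter_upwards [eventually_ne_atTop 0] with n hn
  exact div_mul_cancel₀ _ (by exact_mod_cast hn)

/-- Asymptotic normality of a ratio whose centred numerator is asymptotically a sum of means. -/
lemma IsIIDSample.tendstoInDistribution_ratio {Ω T : Type*} [MeasurableSpace Ω] [MeasurableSpace T]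
    {P : Measure Ω} [IsProbabilityMeasure P] {ν : Measure T} {Z : ℕ → Ω → T}
    (hZ : IsIIDSample P ν Z) {U V : T → ℝ}
    (hU : MemLp U 2 ν) (hU0 : ∫ t, U t ∂ν = 0) (hV : MemLp V 2 ν) (hV0 : ∫ t, V t ∂ν = 0)
    {r : ℕ → ℕ} (hr : ∀ n, r n ≤ n) {γ : ℝ} (hγ : 0 < γ)
    (hrγ : Tendsto (fun n : ℕ => (r n : ℝ) / n) atTop (𝓝 γ)) (hγ1 : γ ≤ 1)
    {S N D : ℕ → Ω → ℝ} {p q : ℝ} (hp : p ≠ 0) (hSm : ∀ n, AEMeasurable (S n) P)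
    (hS : ∀ᶠ x in inProb P, S x.1 x.2 - q = N x.1 x.2 / D x.1 x.2)
    (hN : Tendsto (fun x => √(x.1 : ℝ) * (N x.1 x.2 -
      (sampleMean Z U (r x.1) x.2 + sampleMean Z V x.1 x.2))) (inProb P) (𝓝 0))
    (hD : Tendsto (fun x => D x.1 x.2) (inProb P) (𝓝 p)) :
    0 ≤ meanSumVar ν γ U V ∧ TendstoInDistribution (fun (n : ℕ) ω => √(n : ℝ) * (S n ω - q))
      atTop (id : ℝ → ℝ) (fun _ => P)
      (gaussianReal 0 ((p⁻¹) ^ 2 * meanSumVar ν γ U V).toNNReal) := by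
  have hr_top := tendsto_atTop_of_ratio hγ hrγ
  have hzero {φ : T → ℝ} (h : ∫ t, φ t ∂ν = 0) : ∫ t, p⁻¹ * φ t ∂ν = 0 := by
    rw [integral_const_mul, h, mul_zero]
  refine ⟨(hZ.tendstoInDistribution_two_means hU hU0 hV hV0 hr hγ hrγ hr_top hγ1).1, ?_⟩
  have hclt := (hZ.tendstoInDistribution_two_means (hU.const_mul p⁻¹) (hzero hU0)
    (hV.const_mul p⁻¹) (hzero hV0) hr hγ hrγ hr_top hγ1).2
  rw [meanSumVar_const_mul] at hclt
  refine tendstoInDistribution_of_tendsto_inProb_sub hclt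
    (fun n => ((hSm n).sub_const q).const_mul _) ?_
  have hbdd : BoundedInProb P fun n ω =>
      √(n : ℝ) * (sampleMean Z U (r n) ω + sampleMean Z V n ω) := by
    simp only [mul_add]
    exact ((hZ.boundedInProb_sqrt_mul_sampleMean_real hU hU0).sqrt_smul_comp hγ hrγ hr_top).add
      (hZ.boundedInProb_sqrt_mul_sampleMean_real hV hV0)
  have h := tendsto_div_sub_inv_mul (A := fun n ω => √(n : ℝ) * N n ω) hp
    (by simpa only [mul_sub] using hN) hbdd hD
  refine h.congr' ?_
  filter_upwards [hS] with x hx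
  have hmul (φ : T → ℝ) (m : ℕ) : sampleMean Z (fun t => p⁻¹ * φ t) m x.2 =
      p⁻¹ * sampleMean Z φ m x.2 := by
    simp only [sampleMean, smul_eq_mul, ← Finset.mul_sum]
    ring
  rw [hx, hmul, hmul]
  ring

/-! ### From the given observations to an i.i.d. sample of a binary regression law. -/

namespace SubclassEstimation

variable {Ω : Type*} {f k c : ℕ} {X : ℕ → Ω → Feature f} {Y : ℕ → Ω → Fin c → ℝ} {j : Fin c}
  {g : Feature f → Param k → ℝ} {Θ : Set (Param k)} {θj : Param k} {W : Set (Feature f)}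

lemma qHat_eq (Z : ℕ → Ω → Feature f × ℝ) (hZ : ∀ i ω, (Z i ω).1 = X i ω) (θhat : Ω → Param k)
    (n : ℕ) (ω : Ω) : qHat X g W θhat n ω =
      sampleMean Z (fun z => ind W z.1 * g z.1 (θhat ω)) n ω /
        sampleMean Z (fun z => ind W z.1) n ω := by
  rcases Nat.eq_zero_or_pos n with rfl | hn
  · simp [qHat, sampleMean]
  have hn' : (n : ℝ)⁻¹ ≠ 0 := by positivity
  simp only [qHat, sampleMean, smul_eq_mul, hZ]
  rw [mul_div_mul_left _ _ hn']
  simp only [mul_comm]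

lemma yBar_eq (n m : ℕ) (ω : Ω) : yBar X Y j W m n ω =
      sampleMean (fun i ω => (X i ω, Y i ω j)) (fun z => ind W z.1 * z.2) m ω /
        sampleMean (fun i ω => (X i ω, Y i ω j)) (fun z => ind W z.1) n ω := by
  simp only [yBar, sampleMean, smul_eq_mul, one_div]

variable [MeasurableSpace Ω] {P : Measure Ω}

lemma isIIDSample_pair (hX : ∀ i, Measurable (X i)) (hY : ∀ i, Measurable (Y i))
    (hindep : iIndepFun (fun i ω => (X i ω, Y i ω)) P)
    (hident : ∀ i, IdentDistrib (fun ω => (X i ω, Y i ω)) (fun ω => (X 0 ω, Y 0 ω)) P P)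
    (j : Fin c) :
    IsIIDSample P (P.map fun ω => (X 0 ω, Y 0 ω j)) fun i ω => (X i ω, Y i ω j) := by
  have hj : Measurable fun z : Feature f × (Fin c → ℝ) => (z.1, z.2 j) :=
    measurable_fst.prodMk ((measurable_pi_apply j).comp measurable_snd)
  exact ⟨fun i => (hX i).prodMk ((measurable_pi_apply j).comp (hY i)),
    fun i => ((hident i).comp hj).map_eq, hindep.comp _ fun _ => hj⟩

lemma infoMatrix_eq (hX : Measurable (X 0)) (hY : Measurable (Y 0))
    (hM : BinaryRegression (P.map fun ω => (X 0 ω, Y 0 ω j)) g Θ θj) :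
    infoMatrix P (X 0) g θj = Matrix.of fun a b : Fin k => ∫ z, weight g z.1 θj *
      grad g z.1 θj a * grad g z.1 θj b ∂(P.map fun ω => (X 0 ω, Y 0 ω j)) := by
  have hZ : Measurable fun ω => (X 0 ω, Y 0 ω j) :=
    hX.prodMk ((measurable_pi_apply j).comp hY)
  have hgrad (a : Fin k) := (EuclideanSpace.proj (𝕜 := ℝ) a).continuous.comp_aestronglyMeasurable
    (hM.aestronglyMeasurable_grad hM.mem)
  ext a b
  exact (integral_map hZ.aemeasurable (((hM.measurable_weight θj).aestronglyMeasurable.mul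
    (hgrad a)).mul (hgrad b))).symm

variable [IsProbabilityMeasure P]

/-- A binary `Y` is the indicator of `{Y = 1}`, so pulling the `X`-measurable factor out of the
conditional expectation gives `E[Y h(X)] = E[g h(X)]` for every integrable `h(X)`. This integrated
form of the model is the one used afterwards. -/
lemma binaryRegression_of_model (hX : Measurable (X 0)) (hY : Measurable (Y 0))
    (hY01 : ∀ ω l, Y 0 ω l = 0 ∨ Y 0 ω l = 1)
    (hmodel : P⟦{ω | Y 0 ω j = 1} | MeasurableSpace.comap (X 0) inferInstance⟧
      =ᵐ[P] fun ω => g (X 0 ω) θj)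
    (hθj : θj ∈ interior Θ) (hreg : RegularFamily (P.map (X 0)) g Θ) :
    BinaryRegression (P.map fun ω => (X 0 ω, Y 0 ω j)) g Θ θj := by
  have hYj : Measurable fun ω => Y 0 ω j := (measurable_pi_apply j).comp hY
  have hZ : Measurable fun ω => (X 0 ω, Y 0 ω j) := hX.prodMk hYj
  have hfst : (P.map fun ω => (X 0 ω, Y 0 ω j)).map Prod.fst = P.map (X 0) :=
    Measure.map_map measurable_fst hZ
  have hbin : MeasurableSet {z : Feature f × ℝ | z.2 = 0 ∨ z.2 = 1} :=
    (measurable_snd (measurableSet_singleton (0 : ℝ))).union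
      (measurable_snd (measurableSet_singleton (1 : ℝ)))
  refine ⟨Measure.isProbabilityMeasure_map hZ.aemeasurable,
    (ae_map_iff hZ.aemeasurable hbin).2 (.of_forall fun ω => hY01 ω j), fun h hh => ?_, hθj,
    hfst.symm ▸ hreg⟩
  rw [hfst] at hh
  have hgm := hreg.measurable_apply θj
  have hhX : Integrable (fun ω => h (X 0 ω)) P := hh.comp_measurable hX
  have hmap : AEStronglyMeasurable (fun z : Feature f × ℝ => (z.2 - g z.1 θj) * h z.1)
      (P.map fun ω => (X 0 ω, Y 0 ω j)) := by
    refine (measurable_snd.sub (hgm.comp measurable_fst)).aestronglyMeasurable.mul ?_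
    refine AEStronglyMeasurable.comp_measurable ?_ measurable_fst
    rw [hfst]
    exact hh.aestronglyMeasurable
  rw [integral_map hZ.aemeasurable hmap]
  set s : Set Ω := {ω | Y 0 ω j = 1}
  have hs : MeasurableSet s := hYj (measurableSet_singleton 1)
  have hind (ω : Ω) : s.indicator (fun _ => (1 : ℝ)) ω = Y 0 ω j := by
    rcases hY01 ω j with h0 | h1
    · rw [Set.indicator_of_notMem (by simp [s, h0]), h0]
    · rw [Set.indicator_of_mem (by simp [s, h1]), h1]
  have hcomap : MeasurableSpace.comap (X 0) inferInstance ≤ ‹MeasurableSpace Ω› :=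
    hX.comap_le
  have hmeas : AEStronglyMeasurable[MeasurableSpace.comap (X 0) inferInstance]
      (fun ω => h (X 0 ω)) P :=
    ⟨fun ω => hh.aestronglyMeasurable.mk h (X 0 ω),
      hh.aestronglyMeasurable.stronglyMeasurable_mk.comp_measurable (comap_measurable (X 0)),
      ae_of_ae_map hX.aemeasurable hh.aestronglyMeasurable.ae_eq_mk⟩
  have hprod : Integrable (s.indicator (fun _ => (1 : ℝ)) • fun ω => h (X 0 ω)) P := by
    refine hhX.bdd_smul 1 (measurable_const.indicator hs).aestronglyMeasurable
      (.of_forall fun ω => ?_)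
    rw [hind]
    rcases hY01 ω j with h0 | h1 <;> simp [*]
  have hpull := condExp_smul_of_aestronglyMeasurable_right
    ((integrable_const (1 : ℝ)).indicator hs) hprod hmeas
  have hint := integral_condExp hcomap (μ := P)
    (f := s.indicator (fun _ => (1 : ℝ)) • fun ω => h (X 0 ω))
  have hg : Integrable (fun ω => g (X 0 ω) θj * h (X 0 ω)) P := by
    refine (integrable_condExp (m := MeasurableSpace.comap (X 0) inferInstance)
      (f := s.indicator (fun _ => (1 : ℝ)) • fun ω => h (X 0 ω)) (μ := P)).congr ?_
    filter_upwards [hpull, hmodel] with ω h1 h2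
    rw [h1, Pi.smul_apply', h2, smul_eq_mul]
  have heq : ∫ ω, Y 0 ω j * h (X 0 ω) ∂P = ∫ ω, g (X 0 ω) θj * h (X 0 ω) ∂P := by
    trans ∫ ω, (s.indicator (fun _ => (1 : ℝ)) • fun ω => h (X 0 ω)) ω ∂P
    · exact integral_congr_ae (.of_forall fun ω => by simp [hind])
    rw [← hint]
    refine integral_congr_ae ?_
    filter_upwards [hpull, hmodel] with ω h1 h2
    rw [h1, Pi.smul_apply', h2, smul_eq_mul]
  have hYint : Integrable (fun ω => Y 0 ω j * h (X 0 ω)) P :=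
    hprod.congr (.of_forall fun ω => by simp [hind])
  simp only [sub_mul]
  rw [integral_sub hYint hg, heq, sub_self]

/-- The subclass probability as a ratio of expectations. -/
lemma subclassProb_mul_integral_ind (hX : Measurable (X 0)) (hY : Measurable (Y 0))
    (hY01 : ∀ ω l, Y 0 ω l = 0 ∨ Y 0 ω l = 1) (hW : MeasurableSet W)
    (hPW : 0 < P {ω | X 0 ω ∈ W})
    (hM : BinaryRegression (P.map fun ω => (X 0 ω, Y 0 ω j)) g Θ θj) :
    0 < ∫ z, ind W z.1 ∂(P.map fun ω => (X 0 ω, Y 0 ω j)) ∧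
    subclassProb P (X 0) (Y 0) j W * ∫ z, ind W z.1 ∂(P.map fun ω => (X 0 ω, Y 0 ω j)) =
      ∫ z, ind W z.1 * g z.1 θj ∂(P.map fun ω => (X 0 ω, Y 0 ω j)) := by
  have hprob := hM.prob
  have hYj : Measurable fun ω => Y 0 ω j := (measurable_pi_apply j).comp hY
  have hZ : Measurable fun ω => (X 0 ω, Y 0 ω j) := hX.prodMk hYj
  have hA : MeasurableSet {ω | X 0 ω ∈ W} := hX hW
  have hp : ∫ z, ind W z.1 ∂(P.map fun ω => (X 0 ω, Y 0 ω j)) = P.real {ω | X 0 ω ∈ W} := by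
    have h1 : Measurable fun z : Feature f × ℝ => ind W z.1 :=
      (measurable_ind hW).comp measurable_fst
    rw [integral_map hZ.aemeasurable h1.aestronglyMeasurable]
    exact integral_indicator_one hA
  have hB : MeasurableSet {ω | Y 0 ω j = 1} := hYj (measurableSet_singleton 1)
  have hpos : 0 < P.real {ω | X 0 ω ∈ W} := ENNReal.toReal_pos hPW.ne' (measure_ne_top _ _)
  refine ⟨hp ▸ hpos, ?_⟩
  have hres := (hM.memLp_ind_mul_residual hW).integrable one_le_two
  have hg := (hM.memLp_ind_mul_g hW).integrable one_le_two
  have h0 := hM.integral_ind_mul_residual_mul hW (φ := fun _ => 1)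
    (have := Measure.isProbabilityMeasure_map (μ := P.map fun ω => (X 0 ω, Y 0 ω j))
      measurable_fst.aemeasurable
    integrable_const 1)
  simp only [mul_one] at h0
  have hy : ∫ z, ind W z.1 * z.2 ∂(P.map fun ω => (X 0 ω, Y 0 ω j)) =
      ∫ z, ind W z.1 * g z.1 θj ∂(P.map fun ω => (X 0 ω, Y 0 ω j)) := by
    have h1 := integral_add hres hg
    rw [h0, zero_add] at h1
    rw [← h1]
    congr 1 with z
    ring
  have hy' : ∫ z, ind W z.1 * z.2 ∂(P.map fun ω => (X 0 ω, Y 0 ω j)) =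
      P.real ({ω | X 0 ω ∈ W} ∩ {ω | Y 0 ω j = 1}) := by
    have h1 : Measurable fun z : Feature f × ℝ => ind W z.1 * z.2 :=
      ((measurable_ind hW).comp measurable_fst).mul measurable_snd
    rw [integral_map hZ.aemeasurable h1.aestronglyMeasurable,
      ← integral_indicator_one (hA.inter hB)]
    congr 1 with ω
    by_cases h1 : X 0 ω ∈ W
    · rcases hY01 ω j with h2 | h2 <;> simp [ind, Set.indicator, h1, h2]
    · simp [ind, Set.indicator, h1]
  rw [← hy, hy', hp, subclassProb, measureReal_def, cond_apply hA, ENNReal.toReal_mul,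
    ENNReal.toReal_inv, ← measureReal_def, ← measureReal_def, mul_comm,
    mul_inv_cancel_left₀ hpos.ne']

end SubclassEstimation

/-! ### Comparison of the asymptotic variances. -/

namespace SubclassEstimation.BinaryRegression

variable {f k : ℕ} {ν : Measure (Feature f × ℝ)} {g : Feature f → Param k → ℝ} {Θ : Set (Param k)}
  {θ₀ : Param k} {W : Set (Feature f)} {Ω : Type*} [MeasurableSpace Ω] {P : Measure Ω}
  [IsProbabilityMeasure P] {Z : ℕ → Ω → Feature f × ℝ}

/-- Asymptotic variances of the two estimators of a subclass probability, and their comparison. -/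
lemma exists_asymptotic_variances (hM : BinaryRegression ν g Θ θ₀) (hZ : IsIIDSample P ν Z)
    (hΘ : IsCompact Θ) (hid : ∀ θ ∈ Θ, ∫ z, score g z.1 z.2 θ ∂ν = 0 → θ = θ₀)
    (hA : IsUnit (Matrix.of fun a b : Fin k => ∫ z, weight g z.1 θ₀ * grad g z.1 θ₀ a *
      grad g z.1 θ₀ b ∂ν))
    {r : ℕ → ℕ} (hr : ∀ n, r n ≤ n) {γ : ℝ} (hγ : 0 < γ)
    (hrγ : Tendsto (fun n : ℕ => (r n : ℝ) / n) atTop (𝓝 γ)) (hγ1 : γ ≤ 1)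
    {θhat : ℕ → Ω → Param k} (hroot : ∀ᶠ x in inProb P, θhat x.1 x.2 ∈ Θ ∧
      sampleMean Z (fun z => score g z.1 z.2 (θhat x.1 x.2)) (r x.1) x.2 = 0)
    (hW : MeasurableSet W) (hp : 0 < ∫ z, ind W z.1 ∂ν) {q : ℝ}
    (hq : q * ∫ z, ind W z.1 ∂ν = ∫ z, ind W z.1 * g z.1 θ₀ ∂ν) {S₁ S₂ : ℕ → Ω → ℝ}
    (hS₁ : ∀ n, AEMeasurable (S₁ n) P) (hS₂ : ∀ n, AEMeasurable (S₂ n) P)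
    (hS₁' : ∀ n ω, S₁ n ω = sampleMean Z (fun z => ind W z.1 * g z.1 (θhat n ω)) n ω /
      sampleMean Z (fun z => ind W z.1) n ω)
    (hS₂' : ∀ n ω, S₂ n ω = sampleMean Z (fun z => ind W z.1 * z.2) (r n) ω /
      sampleMean Z (fun z => ind W z.1) n ω) :
    ∃ v₁ v₂ : NNReal, HasAsymptoticVariance P S₁ q v₁ ∧ HasAsymptoticVariance P S₂ q v₂ ∧
      v₁ ≤ v₂ ∧ (γ < 1 → (¬ ∃ a : ℝ, ∀ᵐ z ∂ν, ind W z.1 * g z.1 θ₀ = a) → v₁ < v₂) := by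
  have := hM.prob
  have hr_top := tendsto_atTop_of_ratio hγ hrγ
  obtain ⟨B, hB1, hB2⟩ := hM.exists_inverse_meanInfoOp hA
  set p := ∫ z, ind W z.1 ∂ν
  set m := ∫ z, ind W z.1 * g z.1 θ₀ ∂ν
  set c := B (subclassGrad ν g θ₀ W)
  have hc : meanInfoOp ν g θ₀ c = subclassGrad ν g θ₀ W := hB2 _
  have hθ := hM.tendsto_of_root hZ hΘ hid hr_top hroot
  have hlin (ε : ℝ) (hε : ε > 0) :=
    hM.eventually_norm_sampleMean_score_sub_le hZ hr_top hroot hθ hε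
  have hrate := hM.boundedInProb_sqrt_smul_sub hZ hB1 hγ hrγ hr_top hlin
  have hnum := hM.tendsto_sqrt_mul_sampleMean_sub hZ hW hlin hθ hrate hc
  -- the four square integrable components of the asymptotic expansions
  have hI := hM.memLp_ind hW
  have hIg := hM.memLp_ind_mul_g hW
  let A (z : Feature f × ℝ) : ℝ := ind W z.1 * g z.1 θ₀ - m
  let Q (z : Feature f × ℝ) : ℝ := q * ind W z.1 - m
  let R (z : Feature f × ℝ) : ℝ := ind W z.1 * (z.2 - g z.1 θ₀)
  let S (z : Feature f × ℝ) : ℝ := ⟪score g z.1 z.2 θ₀, c⟫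
  have hAL : MemLp A 2 ν := hIg.sub (memLp_const m)
  have hQL : MemLp Q 2 ν := (hI.const_mul q).sub (memLp_const m)
  have hRL : MemLp R 2 ν := hM.memLp_ind_mul_residual hW
  have hSL : MemLp S 2 ν := by
    have h := hM.memLp_score.continuousLinearMap_comp (innerSL ℝ c)
    simpa only [innerSL_apply_apply, real_inner_comm] using h
  have hA0 : ∫ z, A z ∂ν = 0 := by
    simp only [A]
    rw [integral_sub (hIg.integrable one_le_two) (integrable_const m)]
    simp [m]
  have hQ0 : ∫ z, Q z ∂ν = 0 := by
    simp only [Q]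
    rw [integral_sub ((hI.const_mul q).integrable one_le_two) (integrable_const m),
      integral_const_mul]
    simpa [sub_eq_zero] using hq
  have hfst : IsProbabilityMeasure (ν.map Prod.fst) :=
    Measure.isProbabilityMeasure_map measurable_fst.aemeasurable
  have hR0 : ∫ z, R z ∂ν = 0 := by
    have h := hM.integral_ind_mul_residual_mul hW (φ := fun _ => 1) (integrable_const 1)
    simpa only [mul_one] using h
  have hS0 : ∫ z, S z ∂ν = 0 := by
    have h := hM.integral_inner_score_mul c (φ := fun _ => 1) (memLp_const 1)
    simpa only [mul_one] using h
  have hAfst : MemLp (fun t => ind W t * g t θ₀ - m) 2 (ν.map Prod.fst) :=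
    (memLp_map_measure_iff (((measurable_ind hW).mul
      (hM.regular.measurable_apply θ₀)).sub_const m).aestronglyMeasurable
      measurable_fst.aemeasurable).2 hAL
  have hQfst : MemLp (fun t => q * ind W t - m) 2 (ν.map Prod.fst) :=
    (memLp_map_measure_iff (((measurable_ind hW).const_mul q).sub_const m).aestronglyMeasurable
      measurable_fst.aemeasurable).2 hQL
  -- Both sides equal `⟪E[I_W g'], c⟫`, by the choice of `c`.
  have hRS : ∫ z, R z * S z ∂ν = ∫ z, S z ^ 2 ∂ν := by
    rw [hM.integral_ind_mul_residual_mul_inner_score hW c, hM.integral_inner_score_sq c, hc]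
  have hdiff := meanSumVar_sub_meanSumVar γ hAL hRL hQL hSL
    (hM.integral_ind_mul_residual_mul hW (hAfst.integrable one_le_two))
    (hM.integral_ind_mul_residual_mul hW (hQfst.integrable one_le_two))
    (hM.integral_inner_score_mul c hAfst) (hM.integral_inner_score_mul c hQfst) hRS
  -- the two limit theorems
  have hD := hZ.tendsto_sampleMean (hI.integrable one_le_two) (m := fun n => n) tendsto_id
  have hD0 := hD.eventually_ne hp.ne'
  have hmean (n : ℕ) (ω : Ω) : sampleMean Z (fun z => A z - Q z) n ω =
      sampleMean Z (fun z => ind W z.1 * g z.1 θ₀) n ω -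
        q * sampleMean Z (fun z => ind W z.1) n ω := by
    simp only [A, Q, sub_sub_sub_cancel_right, sampleMean, smul_eq_mul, Finset.sum_sub_distrib,
      ← Finset.mul_sum]
    ring
  obtain ⟨hv1, hlim1⟩ := hZ.tendstoInDistribution_ratio hSL hS0 (hAL.sub hQL)
    (by
      simp only [Pi.sub_apply]
      rw [integral_sub (hAL.integrable one_le_two) (hQL.integrable one_le_two), hA0, hQ0, sub_zero])
    hr hγ hrγ hγ1 (q := q) (N := fun n ω => sampleMean Z
      (fun z => ind W z.1 * g z.1 (θhat n ω)) n ω - q * sampleMean Z (fun z => ind W z.1) n ω)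
    hp.ne' hS₁
    (by
      filter_upwards [hD0] with x hx
      rw [hS₁', sub_div, mul_div_cancel_right₀ _ hx])
    (by
      refine hnum.congr fun x => ?_
      have h := hmean x.1 x.2
      simp only [Pi.sub_def]
      rw [h]
      ring)
    hD
  have hAR (z : Feature f × ℝ) : A z + R z = ind W z.1 * z.2 - m := by
    simp only [A, R]
    ring
  obtain ⟨hv2, hlim2⟩ := hZ.tendstoInDistribution_ratio (U := fun z => A z + R z)
    (V := fun z => -Q z) (hAL.add hRL)
    (by
      rw [integral_add (hAL.integrable one_le_two) (hRL.integrable one_le_two), hA0, hR0, add_zero])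
    hQL.neg (by rw [integral_neg, hQ0, neg_zero])
    hr hγ hrγ hγ1 (q := q) (N := fun n ω => sampleMean Z
      (fun z => ind W z.1 * z.2) (r n) ω - q * sampleMean Z (fun z => ind W z.1) n ω)
    hp.ne' hS₂
    (by
      filter_upwards [hD0] with x hx
      rw [hS₂', sub_div, mul_div_cancel_right₀ _ hx])
    (by
      -- For the ordinary estimator the expansion is exact as soon as `n` and `r n` are positive:
      -- the constants `m` in `A` and `Q` cancel.
      refine tendsto_const_nhds.congr' ?_
      refine (eventually_inProb_of_eventually (P := P)
        ((eventually_gt_atTop 0).and (hr_top.eventually_gt_atTop 0))).mono ?_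
      rintro ⟨n, ω⟩ ⟨hn, hrn⟩
      have hn' : (n : ℝ) ≠ 0 := by positivity
      have hrn' : (r n : ℝ) ≠ 0 := by positivity
      simp only [hAR, Q, sampleMean, smul_eq_mul, Finset.sum_sub_distrib, Finset.sum_neg_distrib,
        ← Finset.mul_sum, Finset.sum_const, Finset.card_range, nsmul_eq_mul]
      field_simp
      ring)
    hD
  have hA2 : 0 ≤ ∫ z, A z ^ 2 ∂ν := integral_nonneg fun _ => sq_nonneg _
  have hRS2 : 0 ≤ ∫ z, (R z - S z) ^ 2 ∂ν := integral_nonneg fun _ => sq_nonneg _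
  have hγinv : 0 ≤ γ⁻¹ - 1 := sub_nonneg.2 ((one_le_inv₀ hγ).2 hγ1)
  have hp2 : 0 < p⁻¹ ^ 2 := by positivity
  refine ⟨_, _, hlim1, hlim2, Real.toNNReal_le_toNNReal ?_, fun hγ' hne => ?_⟩
  · refine mul_le_mul_of_nonneg_left ?_ hp2.le
    rw [← sub_nonneg]
    exact hdiff.symm ▸ add_nonneg (mul_nonneg hγinv hA2) (mul_nonneg (inv_nonneg.2 hγ.le) hRS2)
  -- `E A² = 0` would force `I_W g = m` almost surely. Strictness thus comes from the term `(γ⁻¹ -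
  -- 1) E A²` alone.
  · have hApos : 0 < ∫ z, A z ^ 2 ∂ν := by
      refine lt_of_le_of_ne hA2 fun h0 => hne ⟨m, ?_⟩
      have h1 := (integral_eq_zero_iff_of_nonneg (fun z => sq_nonneg (A z))
        hAL.integrable_sq).1 h0.symm
      filter_upwards [h1] with z hz
      exact sub_eq_zero.1 (pow_eq_zero_iff two_ne_zero |>.1 hz)
    have hlt : meanSumVar ν γ S (fun z => A z - Q z) <
        meanSumVar ν γ (fun z => A z + R z) fun z => -Q z := by
      rw [← sub_pos, hdiff]
      exact add_pos_of_pos_of_nonneg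
        (mul_pos (sub_pos.2 ((one_lt_inv₀ hγ).2 hγ')) hApos)
        (mul_nonneg (inv_nonneg.2 hγ.le) hRS2)
    have hlt' := mul_lt_mul_of_pos_left hlt hp2
    exact (Real.toNNReal_lt_toNNReal_iff (lt_of_le_of_lt (mul_nonneg hp2.le hv1) hlt')).2 hlt'

end SubclassEstimation.BinaryRegression

end

theorem mainTheorem5 {Ω : Type*} [MeasurableSpace Ω] (P : Measure Ω) [IsProbabilityMeasure P]
    {f k c : ℕ}
    -- i.i.d. observations: feature vectors and `0`-`1` class identification vectors
    (X : ℕ → Ω → SubclassEstimation.Feature f) (Y : ℕ → Ω → Fin c → ℝ)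
    (hX : ∀ i, Measurable (X i)) (hY : ∀ i, Measurable (Y i))
    (hY01 : ∀ i ω l, Y i ω l = 0 ∨ Y i ω l = 1)
    (hindep : iIndepFun (fun i ω => (X i ω, Y i ω)) P)
    (hident : ∀ i, IdentDistrib (fun ω => (X i ω, Y i ω)) (fun ω => (X 0 ω, Y 0 ω)) P P)
    -- the first `r n` of the `n` observations are labeled, and `r n / n → γ > 0`
    (r : ℕ → ℕ) (hr : ∀ n, r n ≤ n) (γ : ℝ) (hγ : 0 < γ)
    (hrγ : Tendsto (fun n : ℕ => (r n : ℝ) / (n : ℝ)) atTop (𝓝 γ))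
    -- the class, and the model `P(Y^{(j)} = 1 | X) = g(X, θ_j)`
    (j : Fin c) (g : SubclassEstimation.Feature f → SubclassEstimation.Param k → ℝ)
    (Θ : Set (SubclassEstimation.Param k)) (θj : SubclassEstimation.Param k)
    (hmodel : P⟦{ω | Y 0 ω j = 1} | MeasurableSpace.comap (X 0) inferInstance⟧
      =ᵐ[P] fun ω => g (X 0 ω) θj)
    -- regularity and identifiability
    (hΘ : IsCompact Θ) (hθj : θj ∈ interior Θ)
    (hreg : SubclassEstimation.RegularFamily (P.map (X 0)) g Θ)
    (hidf : ∀ θ ∈ Θ,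
      ∫ ω, SubclassEstimation.score g (X 0 ω) (Y 0 ω j) θ ∂P = 0 → θ = θj)
    (hA : IsUnit (SubclassEstimation.infoMatrix P (X 0) g θj))
    -- with probability tending to one, `θhat n` is a root in `Θ` of the estimating equation
    (θhat : ℕ → Ω → SubclassEstimation.Param k) (hθm : ∀ n, AEMeasurable (θhat n) P)
    (hroot : Tendsto (fun n => P {ω | ¬ (θhat n ω ∈ Θ ∧
      SubclassEstimation.IsRoot X Y j g (r n) ω (θhat n ω))}) atTop (𝓝 0))
    -- the subclass
    (W : Set (SubclassEstimation.Feature f)) (hW : MeasurableSet W)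
    (hPW : 0 < P {ω | X 0 ω ∈ W}) :
    ∃ v₁ v₂ : NNReal,
      SubclassEstimation.HasAsymptoticVariance P
        (fun n => SubclassEstimation.qHat X g W (θhat n) n)
        (SubclassEstimation.subclassProb P (X 0) (Y 0) j W) v₁ ∧
      SubclassEstimation.HasAsymptoticVariance P
        (fun n => SubclassEstimation.yBar X Y j W (r n) n)
        (SubclassEstimation.subclassProb P (X 0) (Y 0) j W) v₂ ∧
      v₁ ≤ v₂ ∧
      (γ < 1 →
        (¬ ∃ a : ℝ, ∀ᵐ ω ∂P,
          SubclassEstimation.ind W (X 0 ω) * g (X 0 ω) θj = a) →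
        v₁ < v₂) := by
  have hZ := SubclassEstimation.isIIDSample_pair hX hY hindep hident j
  have hM := SubclassEstimation.binaryRegression_of_model (hX 0) (hY 0) (hY01 0) hmodel hθj hreg
  set ν := P.map fun ω => (X 0 ω, Y 0 ω j)
  obtain ⟨hp, hqp⟩ :=
    SubclassEstimation.subclassProb_mul_integral_ind (hX 0) (hY 0) (hY01 0) hW hPW hM
  rw [SubclassEstimation.infoMatrix_eq (hX 0) (hY 0) hM] at hA
  have hr_top := tendsto_atTop_of_ratio hγ hrγ
  have hγ1 : γ ≤ 1 := le_of_tendsto hrγ (.of_forall fun n =>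
    div_le_one_of_le₀ (by exact_mod_cast hr n) (Nat.cast_nonneg n))
  have hroot' : ∀ᶠ x in inProb P, θhat x.1 x.2 ∈ Θ ∧
      sampleMean (fun i ω => (X i ω, Y i ω j))
        (fun z => SubclassEstimation.score g z.1 z.2 (θhat x.1 x.2)) (r x.1) x.2 = 0 := by
    have h := eventually_inProb.2 hroot
    filter_upwards [h] with x hx
    refine ⟨hx.1, ?_⟩
    rw [sampleMean, hx.2, smul_zero]
  have hind (i : ℕ) : Measurable fun ω => SubclassEstimation.ind W (X i ω) :=
    (SubclassEstimation.measurable_ind hW).comp (hX i)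
  have hqHat (n : ℕ) : AEMeasurable (SubclassEstimation.qHat X g W (θhat n) n) P := by
    have hg (i : ℕ) : AEMeasurable (fun ω => g (X i ω) (θhat n ω)) P :=
      hreg.measurable.comp_aemeasurable ((hX i).aemeasurable.prodMk (hθm n))
    exact (Finset.aemeasurable_fun_sum _ fun i _ => (hg i).mul (hind i).aemeasurable).div
      (Finset.aemeasurable_fun_sum _ fun i _ => (hind i).aemeasurable)
  have hyBar (n : ℕ) : AEMeasurable (SubclassEstimation.yBar X Y j W (r n) n) P := by
    have hYj (i : ℕ) : Measurable fun ω => Y i ω j := (measurable_pi_apply j).comp (hY i)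
    exact (((Finset.measurable_fun_sum _ fun i _ => (hind i).mul (hYj i)).const_mul _).div
      ((Finset.measurable_fun_sum _ fun i _ => hind i).const_mul _)).aemeasurable
  have hid : ∀ θ ∈ Θ, ∫ z, SubclassEstimation.score g z.1 z.2 θ ∂ν = 0 → θ = θj :=
    fun θ hθ h0 => hidf θ hθ (by
      rw [← h0]
      exact hZ.integral_comp (hM.aestronglyMeasurable_score hθ) 0)
  obtain ⟨v₁, v₂, h₁, h₂, hle, hlt⟩ := hM.exists_asymptotic_variances hZ hΘ hid hA hr hγ hrγ hγ1
    hroot' hW hp hqp hqHat hyBar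
    (fun n ω => SubclassEstimation.qHat_eq (fun i ω => (X i ω, Y i ω j))
      (fun _ _ => rfl) _ _ _)
    (fun n ω => SubclassEstimation.yBar_eq _ _ _)
  refine ⟨v₁, v₂, h₁, h₂, hle, fun hγ' hne => hlt hγ' fun ⟨a, ha⟩ => hne ⟨a, ?_⟩⟩
  filter_upwards [hZ.ae_forall ha] with ω hω using hω 0
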